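/- Setting. Let $n\ge 1$ and let $\Omega\subset\mathbb R^n$ be a bounded open set with $\Omega=\operatorname{int}\overline\Omega$ (for instance a bounded polyhedral Lipschitz domain), with a regular triangulation $\mathcal T$ of $\overline\Omega$ into closed $n$-simplices; let $\mathcal E$ be the set of its sides, $\partial\mathcal T$ their union, $\nu_T$ the outward unit normal of $T\in\mathcal T$, and let each $E\in\mathcal E$ carry a fixed unit normal $\nu_E$, equal to $\nu_T|_E$ for one simplex $T$ with side $E$. Let $\phi:[0,\infty)\to\mathbb R$ be continuous, $C^2$ on $(0,\infty)$, with constants $0<\gamma_1\le\gamma_2$ such that $\gamma_1\le\phi(t)\le\gamma_2$ and $\gamma_1\le\phi(t)+t\phi'(t)\le\gamma_2$ for all $t\ge 0$ (where $t\phi'(t)$ is read as $0$ at $t=0$); put $\sigma(A)=\phi(|A|)A$ for $A\in\mathbb R^n$. Let $f\in L^2(\Omega)$. Let $P_k(\mathcal T)$ be the piecewise polynomials of degree at most $k$, $\nabla_{NC}$ the piecewise gradient, $\Pi_0$ the $L^2(\Omega)$-orthogonal projection onto piecewise constants (componentwise), $\operatorname{mid}(\mathcal T)$ the piecewise constant function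 whose value on $T$ is the barycenter of $T$, $S^1_0(\mathcal T)=P_1(\mathcal T)\cap H^1_0(\Omega)$, $P_0(\mathcal E)$ the functions on $\partial\mathcal T$ that are constant on each side, and $$RT_0(\mathcal T)=\{q\in H(\operatorname{div},\Omega): q=A+b\,(\bullet-\operatorname{mid}(\mathcal T)),\ A\in P_0(\mathcal T;\mathbb R^n),\ b\in P_0(\mathcal T)\}.$$ For $p\in RT_0(\mathcal T)$ and $t_0\in P_0(\mathcal E)$ write $p\cdot\nu=t_0$ if $(p|_T)|_E\cdot\nu_E=t_0|_E$ for every $T\in\mathcal T$ and every side $E$ of $T$. Put $$S_0=\Pi_0\big((\bullet-\operatorname{mid}(\mathcal T))\otimes(\bullet-\operatorname{mid}(\mathcal T))\big),\qquad H_0f=\Pi_0\big(f(\bullet-\operatorname{mid}(\mathcal T))\big).$$ Let $X_h=S^1_0(\mathcal T)\times P_0(\mathcal E)$ and let $Y_h=P_1(\mathcal T)$ carry the scalar product $a(v,w)=\int_\Omega (vw+\nabla_{NC}v\cdot\nabla_{NC}w)\,dx$ with norm $\|v\|_Y=a(v,v)^{1/2}$. For $x_h=(u_C,t_0)\in X_h$,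 $(w_C,s_0)\in X_h$ and $v\in Y_h$ let $F(v)=\int_\Omega fv\,dx$ and $$b(x_h;v)=\int_\Omega\sigma(\nabla u_C)\cdot\nabla_{NC}v\,dx-\langle t_0,v\rangle_{\partial\mathcal T},\qquad b'(x_h;w_C,s_0,v)=\int_\Omega\nabla w_C\cdot\big(D\sigma(\nabla u_C)\nabla_{NC}v\big)\,dx-\langle s_0,v\rangle_{\partial\mathcal T},$$ $$\langle t_0,v\rangle_{\partial\mathcal T}=\sum_{T\in\mathcal T}\ \sum_{E\subset\partial T,\,E\in\mathcal E}\int_E(\nu_T\cdot\nu_E)\,t_0\,v|_T\,ds,\qquad \|F-b(x_h;\bullet)\|_{Y_h^*}=\sup_{v\in Y_h,\ \|v\|_Y\le1}|F(v)-b(x_h;v)|.$$ Finally define, for $u_C\in S^1_0(\mathcal T)$ and $p\in RT_0(\mathcal T)$, $$LS(u_C,p)=\big\|(I+S_0)^{-1/2}\big(\Pi_0p-\sigma(\nabla u_C)+H_0f\big)\big\|_{L^2(\Omega)}^2+\|\Pi_0f+\operatorname{div}p\|_{L^2(\Omega)}^2 .$$ Theorem. (a) Every $x_h=(u_C,t_0)\in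 X_h$ and $p_{RT}\in RT_0(\mathcal T)$ with $p_{RT}\cdot\nu=t_0$ satisfy $\|F-b(x_h;\bullet)\|_{Y_h^*}<\infty$ and $$\|F-b(x_h;\bullet)\|_{Y_h^*}^2=LS(u_C,p_{RT}).$$ (b) Consequently, if $x_h=(u_C,t_0)\in X_h$ is a dPG solution, i.e. a minimizer of $\|F-b(\xi_h;\bullet)\|_{Y_h^*}$ over $\xi_h\in X_h$, and $p_{RT}\in RT_0(\mathcal T)$ satisfies $p_{RT}\cdot\nu=t_0$, then $(u_C,p_{RT})$ minimizes $LS$ over $S^1_0(\mathcal T)\times RT_0(\mathcal T)$. (c) If $x_h=(u_C,t_0)\in X_h$ and some $v_h\in Y_h$ solve the mixed formulation, $a(v_h,\eta)+b(x_h;\eta)=F(\eta)$ for all $\eta\in Y_h$ and $b'(x_h;w_C,s_0,v_h)=0$ for all $(w_C,s_0)\in X_h$, and $p_{RT}\in RT_0(\mathcal T)$ satisfies $p_{RT}\cdot\nu=t_0$, then $(u_C,p_{RT})$ is a stationary point of $LS$: all directional derivatives of $LS$ at $(u_C,p_{RT})$ in directions of $S^1_0(\mathcal T)\times RT_0(\mathcal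 T)$ exist and vanish. -/

import Mathlib

open MeasureTheory

noncomputable section

namespace DPG

/-- Euclidean space `ℝⁿ`. -/
abbrev E (n : ℕ) : Type := EuclideanSpace ℝ (Fin n)

/-! ### Sobolev notions on an open set, through test functions -/

section Sobolev

variable {n : ℕ}

/-- Smooth functions with compact support in `Ω`. -/
def IsTestFunction (Ω : Set (E n)) (χ : E n → ℝ) : Prop :=
  ContDiff ℝ (⊤ : ℕ∞) χ ∧ HasCompactSupport χ ∧ tsupport χ ⊆ Ω

/-- `g ∈ L²(Ω; ℝⁿ)` is the weak gradient of `u` in `Ω`. -/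
def IsWeakGradient (Ω : Set (E n)) (u : E n → ℝ) (g : E n → E n) : Prop :=
  MemLp g 2 (volume.restrict Ω) ∧
    ∀ χ : E n → ℝ, IsTestFunction Ω χ →
      ∫ x in Ω, u x • gradient χ x = - ∫ x in Ω, χ x • g x

/-- A representative of the weak gradient `∇u ∈ L²(Ω; ℝⁿ)`. -/
def weakGrad (Ω : Set (E n)) (u : E n → ℝ) : E n → E n :=
  Classical.epsilon fun g => IsWeakGradient Ω u g

/-- `u ∈ H¹₀(Ω)`, the closure of the test functions in `H¹(Ω)`. -/
def MemH10 (Ω : Set (E n)) (u : E n → ℝ) : Prop :=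
  MemLp u 2 (volume.restrict Ω) ∧
    ∃ g : E n → E n, IsWeakGradient Ω u g ∧
      ∀ ε : ENNReal, 0 < ε → ∃ χ : E n → ℝ, IsTestFunction Ω χ ∧
        eLpNorm (fun x => u x - χ x) 2 (volume.restrict Ω) < ε ∧
        eLpNorm (fun x => g x - gradient χ x) 2 (volume.restrict Ω) < ε

/-- `d ∈ L²(Ω)` is the weak divergence of `q` in `Ω`. -/
def IsWeakDivergence (Ω : Set (E n)) (q : E n → E n) (d : E n → ℝ) : Prop :=
  MemLp d 2 (volume.restrict Ω) ∧
    ∀ χ : E n → ℝ, IsTestFunction Ω χ →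
      ∫ x in Ω, inner ℝ (q x) (gradient χ x) = - ∫ x in Ω, d x * χ x

/-- A representative of the weak divergence `div q ∈ L²(Ω)`. -/
def weakDiv (Ω : Set (E n)) (q : E n → E n) : E n → ℝ :=
  Classical.epsilon fun d => IsWeakDivergence Ω q d

/-- `q ∈ H(div, Ω)`. -/
def MemHdiv (Ω : Set (E n)) (q : E n → E n) : Prop :=
  MemLp q 2 (volume.restrict Ω) ∧ ∃ d : E n → ℝ, IsWeakDivergence Ω q d

end Sobolev

/-! ### Regular triangulations -/

/-- A regular triangulation of `Ω ⊆ ℝⁿ` into `n`-simplices. A simplex is given by the finite set of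
its vertices; two simplices meet exactly in the convex hull of their common vertices. -/
structure Triangulation (n : ℕ) (Ω : Set (E n)) where
  cells : Finset (Finset (E n))
  card_cell : ∀ T ∈ cells, T.card = n + 1
  affineIndependent_cell : ∀ T ∈ cells, AffineIndependent ℝ (fun z : {z // z ∈ T} => (z : E n))
  inter_cell : ∀ S ∈ cells, ∀ T ∈ cells,
    convexHull ℝ (S : Set (E n)) ∩ convexHull ℝ (T : Set (E n)) =
      convexHull ℝ ((S : Set (E n)) ∩ (T : Set (E n)))
  cover : (⋃ T ∈ cells, convexHull ℝ (T : Set (E n))) = closure Ω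

namespace Triangulation

variable {n : ℕ} {Ω : Set (E n)} (Tri : Triangulation n Ω)

open Classical in
/-- The set of all sides (given by their `n` vertices). -/
def sides : Finset (Finset (E n)) :=
  Tri.cells.biUnion fun T => T.powersetCard n

open Classical in
/-- The sides of the simplex `T`. -/
def sidesOf (T : Tri.cells) : Finset Tri.sides :=
  Finset.univ.filter fun F => F.1 ⊆ T.1

/-- The closed simplex with given vertices. -/
abbrev hull (T : Finset (E n)) : Set (E n) := convexHull ℝ (T : Set (E n))

/-- The barycenter of the simplex `T`. -/
def mid (T : Tri.cells) : E n := ((n : ℝ) + 1)⁻¹ • ∑ z ∈ T.1, z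

/-- The function on `Ω` (defined up to a null set) that equals `v T` in the interior of each simplex
`T`. -/
def glue {V : Type*} [AddCommMonoid V] (v : Tri.cells → E n → V) (x : E n) : V :=
  ∑ T : Tri.cells, (interior (hull T.1)).indicator (v T) x

/-- The `L²` projection `Π₀` onto the piecewise constants: the average over each simplex. -/
def Pi0 {V : Type*} [NormedAddCommGroup V] [NormedSpace ℝ V] (g : E n → V) : E n → V :=
  Tri.glue fun T _ => ⨍ y in hull T.1, g y

/-- `mid(𝒯)`, the piecewise constant function of the barycenters. -/
def midField : E n → E n := Tri.glue fun T _ => Tri.mid T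

/-- `v` is the outward unit normal of the simplex `T` along its side `F`. -/
def IsOuterNormal (T F : Finset (E n)) (v : E n) : Prop :=
  ‖v‖ = 1 ∧ (∀ x ∈ F, ∀ y ∈ F, inner ℝ v (x - y) = 0) ∧
    ∀ z ∈ T, z ∉ F → ∀ x ∈ F, inner ℝ v (z - x) < 0

/-- The outward unit normal `ν_T` along the side `F`. -/
def outerNormal (T F : Finset (E n)) : E n := Classical.epsilon fun v => IsOuterNormal T F v

/-- A global choice of unit normals `ν_F` of the sides: `ν_F` is the outward normal along `F` of one
of the simplices that have `F` as a side. -/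
def IsOrientation (ν : Tri.sides → E n) : Prop :=
  ∀ F : Tri.sides, ∃ T : Tri.cells, F ∈ Tri.sidesOf T ∧ IsOuterNormal T.1 F.1 (ν F)

/-! ### Discrete spaces -/

/-- `P₁(𝒯)`: one affine function on each simplex. This is also the test space `Y_h`. -/
abbrev P1 : Type := Tri.cells → (E n →ᵃ[ℝ] ℝ)

/-- `P₀(ℰ)`: one real number on each side. -/
abbrev P0Sides : Type := Tri.sides → ℝ

/-- An element of `P₁(𝒯)` as a function on `Ω`. -/
def P1.toFun {Tri : Triangulation n Ω} (v : Tri.P1) : E n → ℝ := Tri.glue fun T => v T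

/-- The piecewise gradient of an element of `P₁(𝒯)`. -/
def P1.gradNC {Tri : Triangulation n Ω} (v : Tri.P1) : E n → E n :=
  Tri.glue fun T => gradient fun y => v T y

/-- `S¹₀(𝒯) = P₁(𝒯) ∩ H¹₀(Ω)`. -/
def S10 : Set Tri.P1 := {v | MemH10 Ω v.toFun}

/-- The coefficients `(A, b) ∈ P₀(𝒯; ℝⁿ) × P₀(𝒯)` of a piecewise Raviart-Thomas function. -/
abbrev RTCoeff : Type := Tri.cells → E n × ℝ

/-- The polynomial `A + b (x - mid T)` on the simplex `T`. -/
def RTCoeff.onCell {Tri : Triangulation n Ω} (q : Tri.RTCoeff) (T : Tri.cells) (x : E n) : E n :=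
  (q T).1 + (q T).2 • (x - Tri.mid T)

/-- The function `A + b (• - mid(𝒯))` on `Ω`. -/
def RTCoeff.toFun {Tri : Triangulation n Ω} (q : Tri.RTCoeff) : E n → E n := Tri.glue q.onCell

/-- `RT₀(𝒯)`. -/
def RT0 : Set Tri.RTCoeff := {q | MemHdiv Ω q.toFun}

/-- `q · ν = t` in `∂𝒯`: on each side `F` of each simplex `T`, the trace of `(q|_T) · ν_F` is the
constant `t F`. -/
def HasNormalTrace (ν : Tri.sides → E n) (q : Tri.RTCoeff) (t : Tri.P0Sides) : Prop :=
  ∀ T : Tri.cells, ∀ F ∈ Tri.sidesOf T, ∀ x ∈ hull F.1, inner ℝ (q.onCell T x) (ν F) = t F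

/-- The duality bracket `⟨t, v⟩_{∂𝒯}`, a sum over all simplices `T` of the `L²(∂T)` products of
`t_T = (ν_T · ν_F) t` and the trace of `v|_T`, with respect to the surface measure. -/
def bracket (ν : Tri.sides → E n) (t : Tri.P0Sides) (v : Tri.P1) : ℝ :=
  ∑ T : Tri.cells, ∑ F ∈ Tri.sidesOf T,
    ∫ x in hull F.1, (inner ℝ (outerNormal T.1 F.1) (ν F) * t F) * v T x ∂μHE[n - 1]

/-! ### The weights `S₀` and `H₀` -/

/-- `S₀ = Π₀((• - mid(𝒯)) ⊗ (• - mid(𝒯)))`, as a piecewise constant matrix field. -/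
def S0 (x : E n) : Matrix (Fin n) (Fin n) ℝ :=
  Matrix.of fun i j => Tri.Pi0 (fun y => (y - Tri.midField y) i * (y - Tri.midField y) j) x

/-- `H₀ f = Π₀(f (• - mid(𝒯)))`. -/
def H0 (f : E n → ℝ) : E n → E n := Tri.Pi0 fun y => f y • (y - Tri.midField y)

/-- `(I + S₀)^{-1/2}`, through the functional calculus of symmetric matrices. -/
def weight (x : E n) : Matrix (Fin n) (Fin n) ℝ :=
  cfc (fun s : ℝ => s ^ (-(1 / 2) : ℝ)) (1 + Tri.S0 x)

end Triangulation

/-! ### The nonlinear model problem -/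

/-- Standing assumptions on `ϕ` and the constants `γ₁`, `γ₂`. Only the values of `ϕ` on `[0, ∞)`
matter. -/
structure IsAdmissible (ϕ : ℝ → ℝ) (γ₁ γ₂ : ℝ) : Prop where
  pos : 0 < γ₁
  continuousOn : ContinuousOn ϕ (Set.Ici 0)
  contDiffOn : ContDiffOn ℝ 2 ϕ (Set.Ioi 0)
  bounds : ∀ t : ℝ, 0 ≤ t → γ₁ ≤ ϕ t ∧ ϕ t ≤ γ₂
  bounds_deriv : ∀ t : ℝ, 0 ≤ t → γ₁ ≤ ϕ t + t * deriv ϕ t ∧ ϕ t + t * deriv ϕ t ≤ γ₂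

/-- `σ(A) = ϕ(|A|) A`. -/
def sigma {n : ℕ} (ϕ : ℝ → ℝ) (A : E n) : E n := ϕ ‖A‖ • A

section Method

open Triangulation

variable {n : ℕ} {Ω : Set (E n)} (Tri : Triangulation n Ω) (ν : Tri.sides → E n)
  (ϕ : ℝ → ℝ) (f : E n → ℝ)

/-- The scalar product `a` of `Y = H¹(𝒯)` on `Y_h = P₁(𝒯)`. -/
def scalarY (v w : Tri.P1) : ℝ :=
  ∫ x in Ω, (v.toFun x * w.toFun x + inner ℝ (v.gradNC x) (w.gradNC x))

/-- The norm of `Y = H¹(𝒯)` on `Y_h = P₁(𝒯)`. -/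
def normY (v : Tri.P1) : ℝ := Real.sqrt (scalarY Tri v v)

/-- `F(v) = ∫_Ω f v dx`. -/
def load (v : Tri.P1) : ℝ := ∫ x in Ω, f x * v.toFun x

/-- `b(u, t; v) = ∫_Ω σ(∇u) · ∇_NC v dx - ⟨t, v⟩_{∂𝒯}`. -/
def formB (u : Tri.P1) (t : Tri.P0Sides) (v : Tri.P1) : ℝ :=
  (∫ x in Ω, inner ℝ (sigma ϕ (weakGrad Ω u.toFun x)) (v.gradNC x)) - Tri.bracket ν t v

/-- `b'(u, t; w, s, v) = ∫_Ω ∇w · (Dσ(∇u) ∇_NC v) dx - ⟨s, v⟩_{∂𝒯}`. -/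
def formB' (u w : Tri.P1) (s : Tri.P0Sides) (v : Tri.P1) : ℝ :=
  (∫ x in Ω, inner ℝ (weakGrad Ω w.toFun x)
    (fderiv ℝ (sigma ϕ) (weakGrad Ω u.toFun x) (v.gradNC x))) - Tri.bracket ν s v

/-- The values `|F(v) - b(u, t; v)|` over the unit ball of `Y_h`. -/
def residualSet (u : Tri.P1) (t : Tri.P0Sides) : Set ℝ :=
  {r | ∃ v : Tri.P1, normY Tri v ≤ 1 ∧ r = |load Tri f v - formB Tri ν ϕ u t v|}

/-- The dual norm `‖F - b(u, t; •)‖_{Y_h^*}`. -/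
def residualNorm (u : Tri.P1) (t : Tri.P0Sides) : ℝ := sSup (residualSet Tri ν ϕ f u t)

/-- `(u, t)` is a solution of the dPG method: it minimizes the residual norm over
`X_h = S¹₀(𝒯) × P₀(ℰ)`. -/
def IsDPGSolution (u : Tri.P1) (t : Tri.P0Sides) : Prop :=
  u ∈ Tri.S10 ∧ ∀ w ∈ Tri.S10, ∀ s : Tri.P0Sides,
    residualNorm Tri ν ϕ f u t ≤ residualNorm Tri ν ϕ f w s

/-- `(u, t; v)` solves the mixed formulation. -/
def IsMixedSolution (u : Tri.P1) (t : Tri.P0Sides) (v : Tri.P1) : Prop :=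
  u ∈ Tri.S10 ∧
    (∀ η : Tri.P1, scalarY Tri v η + formB Tri ν ϕ u t η = load Tri f η) ∧
    ∀ w ∈ Tri.S10, ∀ s : Tri.P0Sides, formB' Tri ν ϕ u w s v = 0

/-- The weighted least-squares functional
`‖(I + S₀)^{-1/2} (Π₀ p - σ(∇u) + H₀ f)‖² + ‖Π₀ f + div p‖²`. -/
def leastSquares (u : Tri.P1) (p : Tri.RTCoeff) : ℝ :=
  (∫ x in Ω, ‖Matrix.toEuclideanLin (Tri.weight x)
      (Tri.Pi0 p.toFun x - sigma ϕ (weakGrad Ω u.toFun x) + Tri.H0 f x)‖ ^ 2) +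
    ∫ x in Ω, (Tri.Pi0 f x + weakDiv Ω p.toFun x) ^ 2

end Method

end DPG

end

/-! The functional LS is the squared norm of the Riesz representative of the residual F - b(x_h; •)
in Y_h, and this can be computed exactly on each cell. Write a test function on T as v = v(mid T) +
∇v · (x - mid T). The linear part has mean zero, so a(v, w) becomes the sum of |T| (v(mid T) w(mid
T) + (I + S₀)∇v · ∇w) (`scalarY_eq`), and F(v) the sum of |T| (Π₀f v(mid T) + H₀f · ∇v) (`load_eq`).
If p · ν = t₀, the divergence theorem turns ⟨t₀, v⟩ into the sum of |T| (Π₀p · ∇v + div p v(mid T))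
(`bracket_eq`). Hence the residual pairs v(mid T) with Π₀f + div p, and ∇v with Π₀p - σ(∇u_C) + H₀f.
Its representative has the first as barycentric value and (I + S₀)⁻¹ times the second as gradient
(`residual_eq_riesz`). The square of its norm is LS (`scalarY_riesz`), and Cauchy-Schwarz gives (a).

For (b) and (c), competitors or directions in RT₀ must be matched with elements of P₀(ℰ): every q in
RT₀ has a single-valued, sidewise constant normal trace (`exists_hasNormalTrace`). The weak
divergence is tested near the barycenter of an interior side, where the jump of q lives on a
half-space. A scaling argument isolates its constant part, and a translation argument shows that
this part has no normal component (`normal_jump_eq_zero`). Then (b) follows by comparing the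
residual norms. In (c), v_h must be the Riesz representative, and the derivative of LS in direction
(w, q) is -2 b'(x_h; w, s, v_h) with s = q · ν, because Dσ is symmetric.

Facet integrals are reduced to volumes: the surface measure of a set in a facet is a multiple of the
volume of the cone over it (`volume_cone`). Affine maps that swap vertices preserve volume, hence
surface measure, and symmetry then determines the integrals of affine functions. -/

set_option linter.unusedSectionVars false

noncomputable section

namespace DPG

open Set

/-! ### Affine functions on Euclidean space -/

section Affine

variable {n : ℕ}

/-- The constant gradient of an affine function. -/
def affGrad (v : E n →ᵃ[ℝ] ℝ) : E n :=
  (InnerProductSpace.toDual ℝ (E n)).symm (LinearMap.toContinuousLinearMap v.linear)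

lemma inner_affGrad (v : E n →ᵃ[ℝ] ℝ) (y : E n) : inner ℝ (affGrad v) y = v.linear y := by
  simp [affGrad]

lemma affine_eq (v : E n →ᵃ[ℝ] ℝ) (x y : E n) : v x = v y + inner ℝ (affGrad v) (x - y) := by
  rw [inner_affGrad, ← vsub_eq_sub, AffineMap.linearMap_vsub]
  simp

lemma continuous_affine (v : E n →ᵃ[ℝ] ℝ) : Continuous v :=
  v.continuous_of_finiteDimensional

lemma hasFDerivAt_affine (v : E n →ᵃ[ℝ] ℝ) (x : E n) :
    HasFDerivAt (fun y => v y) (LinearMap.toContinuousLinearMap v.linear) x := by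
  have : (fun y => v y) = fun y => v 0 + LinearMap.toContinuousLinearMap v.linear y := by
    ext y
    rw [affine_eq v y 0, inner_affGrad]
    simp
  rw [this]
  exact (ContinuousLinearMap.hasFDerivAt _).const_add _

lemma fderiv_affine (v : E n →ᵃ[ℝ] ℝ) (x e : E n) :
    fderiv ℝ (fun y => v y) x e = inner ℝ (affGrad v) e := by
  rw [(hasFDerivAt_affine v x).fderiv, inner_affGrad]
  simp

lemma gradient_affine (v : E n →ᵃ[ℝ] ℝ) (x : E n) : gradient (fun y => v y) x = affGrad v := by
  rw [gradient, (hasFDerivAt_affine v x).fderiv, affGrad]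

lemma affGrad_add (v w : E n →ᵃ[ℝ] ℝ) : affGrad (v + w) = affGrad v + affGrad w := by
  simp [affGrad]

lemma affGrad_smul (c : ℝ) (v : E n →ᵃ[ℝ] ℝ) : affGrad (c • v) = c • affGrad v := by
  simp [affGrad]

/-- The affine function with prescribed value at `m` and gradient. -/
def affOf (m : E n) (c : ℝ) (G : E n) : E n →ᵃ[ℝ] ℝ :=
  AffineMap.const ℝ (E n) (c - inner ℝ G m) + (innerₗ (E n) G).toAffineMap

lemma affOf_apply (m : E n) (c : ℝ) (G x : E n) : affOf m c G x = c + inner ℝ G (x - m) := by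
  simp [affOf, inner_sub_right]
  ring

lemma affGrad_affOf (m : E n) (c : ℝ) (G : E n) : affGrad (affOf m c G) = G := by
  refine ext_inner_right ℝ fun y => ?_
  rw [inner_affGrad]
  simp [affOf]

end Affine

/-! ### Simplices -/

section Simplex

variable {n : ℕ} {ι : Type*} [Fintype ι] (b : AffineBasis ι ℝ (E n))

lemma coord_affGrad_diff (i j k : ι) :
    inner ℝ (affGrad (b.coord k)) (b j - b i) = b.coord k (b j) - b.coord k (b i) := by
  rw [affine_eq (b.coord k) (b j) (b i)]
  ring

lemma affine_eq_sum (v : E n →ᵃ[ℝ] ℝ) (x : E n) : v x = ∑ i, b.coord i x * v (b i) := by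
  have h0 : ∑ i, b.coord i x = 1 := b.sum_coord_apply_eq_one x
  have h1 : ∑ i, b.coord i x • b i = x := b.linear_combination_coord_eq_self x
  have h2 : ∀ i, b.coord i x * v (b i) =
      b.coord i x * v x + inner ℝ (affGrad v) (b.coord i x • b i - b.coord i x • x) := by
    intro i
    rw [affine_eq v (b i) x, ← smul_sub, inner_smul_right]
    ring
  simp_rw [h2]
  rw [Finset.sum_add_distrib, ← Finset.sum_mul, h0, ← inner_sum, Finset.sum_sub_distrib, h1,
    ← Finset.sum_smul, h0]
  simp

lemma affGrad_eq_sum (v : E n →ᵃ[ℝ] ℝ) :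
    affGrad v = ∑ i, v (b i) • affGrad (b.coord i) := by
  refine ext_inner_right ℝ fun y => ?_
  have h := affine_eq_sum b v y
  have h0 := affine_eq_sum b v 0
  have e1 := affine_eq v y 0
  rw [sum_inner]
  have : ∀ i, inner ℝ (v (b i) • affGrad (b.coord i)) y =
      b.coord i y * v (b i) - b.coord i 0 * v (b i) := by
    intro i
    rw [affine_eq (b.coord i) y 0, inner_smul_left, sub_zero]
    simp
    ring
  simp_rw [this, Finset.sum_sub_distrib, ← h, ← h0, e1]
  simp

lemma sum_affGrad_coord : ∑ i, affGrad (b.coord i) = 0 := by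
  have := affGrad_eq_sum b (AffineMap.const ℝ (E n) 1)
  simp only [AffineMap.const_apply, one_smul] at this
  rw [← this]
  simp [affGrad]

variable [DecidableEq ι]

/-- The affine map that swaps the vertices `i` and `j` and fixes the others. -/
def swapMap (i j : ι) (x : E n) : E n := x + (b.coord i x - b.coord j x) • (b j - b i)

lemma coord_swapMap (i j k : ι) (x : E n) :
    b.coord k (swapMap b i j x) = b.coord (Equiv.swap i j k) x := by
  have : b.coord k (swapMap b i j x) =
      b.coord k x + (b.coord i x - b.coord j x) * (b.coord k (b j) - b.coord k (b i)) := by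
    rw [affine_eq (b.coord k) _ x, ← coord_affGrad_diff, swapMap, add_sub_cancel_left,
      inner_smul_right]
  rw [this]
  simp only [AffineBasis.coord_apply]
  by_cases hi : k = i
  · subst hi
    by_cases hj : k = j
    · subst hj; simp
    · simp [hj]
  · by_cases hj : k = j
    · subst hj; simp [hi]
    · simp [hi, hj, Equiv.swap_apply_of_ne_of_ne hi hj]

lemma swapMap_swapMap (i j : ι) (x : E n) : swapMap b i j (swapMap b i j x) = x := by
  refine b.ext_elem fun k => ?_
  rw [coord_swapMap, coord_swapMap, Equiv.swap_apply_self]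

lemma continuous_swapMap (i j : ι) : Continuous (swapMap b i j) := by
  unfold swapMap
  have := continuous_affine (b.coord i)
  have := continuous_affine (b.coord j)
  fun_prop

lemma swapMap_vertex (i j k : ι) (hi : k ≠ i) (hj : k ≠ j) : swapMap b i j (b k) = b k := by
  simp [swapMap, hi.symm, hj.symm]

/-- `swapMap` as a homeomorphism. -/
def swapHomeo (i j : ι) : E n ≃ₜ E n where
  toFun := swapMap b i j
  invFun := swapMap b i j
  left_inv := swapMap_swapMap b i j
  right_inv := swapMap_swapMap b i j
  continuous_toFun := continuous_swapMap b i j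
  continuous_invFun := continuous_swapMap b i j

/-- The linear part of `swapMap`. -/
def swapLin (i j : ι) : E n →ₗ[ℝ] E n :=
  LinearMap.id + LinearMap.smulRight ((b.coord i).linear - (b.coord j).linear) (b j - b i)

lemma swapMap_eq (i j : ι) (x y : E n) : swapMap b i j (x + y) = swapMap b i j x + swapLin b i j y := by
  simp only [swapMap, swapLin, affine_eq (b.coord i) (x + y) x, affine_eq (b.coord j) (x + y) x,
    add_sub_cancel_left, inner_affGrad, LinearMap.add_apply, LinearMap.id_apply,
    LinearMap.smulRight_apply, LinearMap.sub_apply]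
  module

lemma swapLin_swapLin (i j : ι) : swapLin b i j ∘ₗ swapLin b i j = LinearMap.id := by
  ext1 y
  have h := swapMap_swapMap b i j (0 + y)
  rw [swapMap_eq, swapMap_eq, swapMap_swapMap] at h
  simpa using h

lemma swapMap_homothety (i j k : ι) (hi : k ≠ i) (hj : k ≠ j) (c : ℝ) (x : E n) :
    swapMap b i j (AffineMap.homothety (b k) c x) =
      AffineMap.homothety (b k) c (swapMap b i j x) := by
  have h1 : AffineMap.homothety (b k) c x = b k + c • (x - b k) := by
    simp [AffineMap.homothety_apply, add_comm]
  have h2 : swapMap b i j x = b k + swapLin b i j (x - b k) := by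
    conv_lhs => rw [← add_sub_cancel (b k) x, swapMap_eq, swapMap_vertex b i j k hi hj]
  rw [h1, swapMap_eq, swapMap_vertex b i j k hi hj, h2, map_smul]
  simp [AffineMap.homothety_apply, add_comm]

/-- The linear part is an involution, so its determinant squares to 1 and has absolute value 1. -/
lemma measurePreserving_swapMap (i j : ι) :
    MeasurePreserving (swapMap b i j) (volume : Measure (E n)) volume := by
  have hd : LinearMap.det (swapLin b i j) * LinearMap.det (swapLin b i j) = 1 := by
    rw [← LinearMap.det_comp, swapLin_swapLin, LinearMap.det_id]
  have h0 : LinearMap.det (swapLin b i j) ≠ 0 := fun h => by simp [h] at hd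
  have h1 : MeasurePreserving (swapLin b i j) (volume : Measure (E n)) volume := by
    refine ⟨(LinearMap.continuous_of_finiteDimensional _).measurable, ?_⟩
    rw [Measure.map_linearMap_addHaar_eq_smul_addHaar _ h0]
    have : |(LinearMap.det (swapLin b i j))⁻¹| = 1 := by
      rw [abs_inv, inv_eq_one]
      have := abs_mul_abs_self (LinearMap.det (swapLin b i j))
      rw [hd] at this
      nlinarith [abs_nonneg (LinearMap.det (swapLin b i j))]
    rw [this]
    simp
  have h2 : swapMap b i j = (fun x => swapMap b i j 0 + x) ∘ swapLin b i j := by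
    ext1 x
    simp [← swapMap_eq]
  rw [h2]
  exact (measurePreserving_add_left volume _).comp h1

/-- If a measure on a set is invariant under swapping vertices in `I`, then the barycentric
coordinates in `I` have the same integral. -/
lemma setIntegral_coord_of_invariant {μ : Measure (E n)} {s : Set (E n)} (I : Finset ι)
    (hs : ∀ x ∈ s, ∀ i, 0 ≤ b.coord i x) (hI : ∀ x ∈ s, ∀ i, i ∉ I → b.coord i x = 0)
    (hsm : MeasurableSet s) (hμ : μ s ≠ ⊤)
    (hinv : ∀ i ∈ I, ∀ j ∈ I, MeasurePreserving (swapMap b i j) (μ.restrict s) (μ.restrict s))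
    (v : E n →ᵃ[ℝ] ℝ) :
    (∀ v : E n →ᵃ[ℝ] ℝ, IntegrableOn (fun x => v x) s μ) ∧
    (I.card : ℝ) * ∫ x in s, v x ∂μ = μ.real s * ∑ i ∈ I, v (b i) := by
  have : IsFiniteMeasure (μ.restrict s) := ⟨by simpa using hμ.lt_top⟩
  have hsum : ∀ x ∈ s, ∑ i ∈ I, b.coord i x = 1 := by
    intro x hx
    rw [← b.sum_coord_apply_eq_one x]
    exact Finset.sum_subset (Finset.subset_univ _) fun i _ hi => hI x hx i hi
  have hint : ∀ i, IntegrableOn (fun x => b.coord i x) s μ := by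
    intro i
    refine Measure.integrableOn_of_bounded (M := 1) hμ
      (continuous_affine _).aestronglyMeasurable ?_
    refine (ae_restrict_iff' hsm).2 (.of_forall fun x hx => ?_)
    rw [Real.norm_of_nonneg (hs x hx i), ← b.sum_coord_apply_eq_one x]
    exact Finset.single_le_sum (f := fun i => b.coord i x) (fun i _ => hs x hx i)
      (Finset.mem_univ i)
  have heq : ∀ i ∈ I, ∀ j ∈ I, ∫ x in s, b.coord i x ∂μ = ∫ x in s, b.coord j x ∂μ := by
    intro i hi j hj
    have := (hinv i hi j hj).integral_comp (swapHomeo b i j).measurableEmbedding (fun x => b.coord i x)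
    rw [← this]
    simp_rw [coord_swapMap, Equiv.swap_apply_left]
  -- The coordinates in `I` have equal integrals and sum to one on `s`.
  have hval : ∀ i ∈ I, (I.card : ℝ) * ∫ x in s, b.coord i x ∂μ = μ.real s := by
    intro i hi
    have h1 : ∫ x in s, ∑ j ∈ I, b.coord j x ∂μ = μ.real s := by
      rw [setIntegral_congr_fun hsm hsum]
      simp
    rw [integral_finsetSum _ fun j _ => hint j, Finset.sum_congr rfl fun j hj => heq j hj i hi] at h1
    simpa using h1
  refine ⟨fun v => ?_, ?_⟩
  · have : (fun x => v x) = fun x => ∑ i, b.coord i x * v (b i) := by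
      ext x; exact affine_eq_sum b v x
    rw [this]
    exact integrable_finsetSum _ fun i _ => (hint i).mul_const _
  · have : ∫ x in s, v x ∂μ = ∫ x in s, ∑ i ∈ I, b.coord i x * v (b i) ∂μ := by
      refine setIntegral_congr_fun hsm fun x hx => ?_
      rw [affine_eq_sum b v x]
      exact (Finset.sum_subset (Finset.subset_univ _) fun i _ hi => by rw [hI x hx i hi, zero_mul]).symm
    rw [this, integral_finsetSum _ fun i _ => (hint i).mul_const _, Finset.mul_sum, Finset.mul_sum]
    refine Finset.sum_congr rfl fun i hi => ?_
    rw [integral_mul_const, ← mul_assoc, hval i hi]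

end Simplex

/-! ### Integrals over simplices and facets -/

section SimplexIntegrals

variable {n : ℕ} {ι : Type*} [Fintype ι] [DecidableEq ι] (b : AffineBasis ι ℝ (E n))

lemma measure_convexHull_ne_top : volume (convexHull ℝ (range b)) ≠ ⊤ :=
  ((finite_range b).isCompact_convexHull ℝ).measure_lt_top.ne

lemma preimage_swapMap_convexHull (i j : ι) :
    swapMap b i j ⁻¹' convexHull ℝ (range b) = convexHull ℝ (range b) := by
  ext x
  simp only [b.convexHull_eq_nonneg_coord, mem_preimage, mem_ofPred_eq, coord_swapMap]
  exact ⟨fun h k => by simpa using h (Equiv.swap i j k), fun h k => h _⟩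

lemma setIntegral_simplex (v : E n →ᵃ[ℝ] ℝ) :
    IntegrableOn (fun x => v x) (convexHull ℝ (range b)) ∧
    (Fintype.card ι : ℝ) * ∫ x in convexHull ℝ (range b), v x =
      volume.real (convexHull ℝ (range b)) * ∑ i, v (b i) := by
  have hm : MeasurableSet (convexHull ℝ (range b)) :=
    ((finite_range b).isClosed_convexHull ℝ).measurableSet
  have h := setIntegral_coord_of_invariant b (μ := volume) (s := convexHull ℝ (range b))
    Finset.univ ?_ (fun x _ i hi => absurd (Finset.mem_univ i) hi) hm
    (measure_convexHull_ne_top b) ?_ v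
  · exact ⟨h.1 v, h.2⟩
  · intro x hx i
    rw [b.convexHull_eq_nonneg_coord] at hx
    exact hx i
  · intro i _ j _
    have := (measurePreserving_swapMap b i j).restrict_preimage hm
    rwa [preimage_swapMap_convexHull] at this

/-- The cone with apex `b k` over a set `B` in the hyperplane of the facet opposite to `b k`. -/
def cone (k : ι) (B : Set (E n)) : Set (E n) :=
  {x | b.coord k x < 1 ∧ 0 ≤ b.coord k x ∧
    AffineMap.homothety (b k) (1 - b.coord k x)⁻¹ x ∈ B}

lemma coord_homothety (k : ι) (c : ℝ) (x : E n) :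
    b.coord k (AffineMap.homothety (b k) c x) = 1 + c * (b.coord k x - 1) := by
  have h1 : AffineMap.homothety (b k) c x = b k + c • (x - b k) := by
    simp [AffineMap.homothety_apply, add_comm]
  rw [h1, affine_eq _ _ (b k), add_sub_cancel_left, inner_smul_right, affine_eq _ x (b k)]
  simp

/-- The coordinate takes the value 1 at its own vertex and 0 at any other, so it is not constant. -/
lemma affGrad_coord_ne_zero [Nontrivial ι] (k : ι) : affGrad (b.coord k) ≠ 0 := by
  intro h
  obtain ⟨j, hj⟩ := exists_ne k
  have := affine_eq (b.coord k) (b k) (b j)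
  simp [h, hj.symm] at this

lemma measurableSet_cone (k : ι) {B : Set (E n)} (hB : MeasurableSet B) :
    MeasurableSet (cone b k B) := by
  have hc := (continuous_affine (b.coord k)).measurable
  have hh : Measurable fun x : E n => AffineMap.homothety (b k) (1 - b.coord k x)⁻¹ x := by
    simp only [AffineMap.homothety_apply, vsub_eq_sub, vadd_eq_add]
    fun_prop
  exact (measurableSet_lt hc measurable_const).inter
    ((measurableSet_le measurable_const hc).inter (hh hB))

open scoped ENNReal

lemma lintegral_Ioc_pow (m : ℕ) :
    ∫⁻ s in Ioc (0 : ℝ) 1, ENNReal.ofReal (s ^ m) = ENNReal.ofReal ((m : ℝ) + 1)⁻¹ := by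
  rw [← ofReal_integral_eq_lintegral_ofReal]
  · rw [← intervalIntegral.integral_of_le zero_le_one, integral_pow]
    simp
  · exact ((continuous_pow m).integrableOn_Icc).mono_set Ioc_subset_Icc_self
  · exact (ae_restrict_iff' measurableSet_Ioc).2 (.of_forall fun x hx => pow_nonneg hx.1.le _)

/-- The volume of a cone is the measure of its base times the height over `n`. -/
lemma volume_cone (hn : 1 ≤ n) [Nontrivial ι] (k : ι) {B : Set (E n)} (hB : MeasurableSet B)
    (hB0 : ∀ x ∈ B, b.coord k x = 0) :
    volume (cone b k B) =
      ENNReal.ofReal ((n : ℝ) * ‖affGrad (b.coord k)‖)⁻¹ * μHE[n - 1] B := by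
  set g := affGrad (b.coord k) with hg
  have hg0 : g ≠ 0 := affGrad_coord_ne_zero b k
  have hgn : 0 < ‖g‖ := norm_pos_iff.2 hg0
  -- Along `v` the coordinate of `b k` decreases at unit rate, so the hyperplane orthogonal to `v`
  -- through `b k + s • v` is the level set where the coordinate equals 1 - s.
  set v : E n := -(‖g‖ ^ 2)⁻¹ • g with hv
  have hv0 : v ≠ 0 := by
    rw [hv]; exact smul_ne_zero (neg_ne_zero.2 (by positivity)) hg0
  have hvn : ‖v‖ = ‖g‖⁻¹ := by
    rw [hv, norm_smul, norm_neg, norm_inv, norm_pow, norm_norm]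
    field_simp
  have hgv : inner ℝ g v = -1 := by
    rw [hv, inner_smul_right, real_inner_self_eq_norm_sq]
    field_simp
  have hmem : ∀ (s : ℝ) (x : E n),
      x ∈ (AffineSubspace.mk' (s • v +ᵥ b k) (Submodule.span ℝ {v})ᗮ : Set (E n)) ↔
        b.coord k x = 1 - s := by
    intro s x
    rw [SetLike.mem_coe, AffineSubspace.mem_mk', Submodule.mem_orthogonal_singleton_iff_inner_right]
    have h1 : b.coord k x = 1 - s + inner ℝ g (x - (s • v + b k)) := by
      rw [affine_eq (b.coord k) x (b k), ← hg]
      simp only [inner_sub_right, inner_add_right, inner_smul_right, hgv, b.coord_apply_eq]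
      ring
    have h2 : inner ℝ v (x - (s • v + b k)) = -(‖g‖ ^ 2)⁻¹ * inner ℝ g (x - (s • v + b k)) := by
      generalize x - (s • v + b k) = w
      rw [hv, inner_smul_left]
      simp
    rw [vsub_eq_sub, vadd_eq_add, h2, h1]
    have : -(‖g‖ ^ 2)⁻¹ ≠ 0 := neg_ne_zero.2 (by positivity)
    constructor
    · intro h
      rcases mul_eq_zero.1 h with h | h
      · exact absurd h this
      · rw [h, add_zero]
    · intro h
      rw [show inner ℝ g (x - (s • v + b k)) = 0 by linarith, mul_zero]
  -- For s in (0, 1] the slice at level s is the copy of `B` scaled by s about the apex; the other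
  -- slices are empty.
  have hslice : ∀ s : ℝ, μHE[n - 1] (cone b k B ∩
      (AffineSubspace.mk' (s • v +ᵥ b k) (Submodule.span ℝ {v})ᗮ : Set (E n))) =
        (Ioc (0 : ℝ) 1).indicator (fun s => ENNReal.ofReal (s ^ (n - 1)) * μHE[n - 1] B) s := by
    intro s
    by_cases hs : s ∈ Ioc (0 : ℝ) 1
    · rw [indicator_of_mem hs]
      have : cone b k B ∩
          (AffineSubspace.mk' (s • v +ᵥ b k) (Submodule.span ℝ {v})ᗮ : Set (E n)) =
          AffineMap.homothety (b k) s⁻¹ ⁻¹' B := by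
        ext x
        rw [mem_inter_iff, hmem, mem_preimage, cone, mem_ofPred_eq]
        constructor
        · rintro ⟨⟨_, _, h⟩, hx⟩
          rwa [hx, sub_sub_cancel] at h
        · intro h
          have h0 := hB0 _ h
          rw [coord_homothety] at h0
          have hx : b.coord k x = 1 - s := by
            have := hs.1.ne'
            field_simp at h0
            linarith
          refine ⟨⟨?_, ?_, ?_⟩, hx⟩
          · rw [hx]; linarith [hs.1]
          · rw [hx]; linarith [hs.2]
          · rwa [hx, sub_sub_cancel]
      rw [this, euclideanHausdorffMeasure_homothety_preimage _ _ (inv_ne_zero hs.1.ne'),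
        ENNReal.smul_def, smul_eq_mul]
      congr 1
      rw [nnnorm_inv, inv_inv, ENNReal.coe_pow, ENNReal.ofReal_pow hs.1.le]
      congr 1
      exact (Real.enorm_eq_ofReal hs.1.le)
    · rw [indicator_of_notMem hs]
      have : cone b k B ∩
          (AffineSubspace.mk' (s • v +ᵥ b k) (Submodule.span ℝ {v})ᗮ : Set (E n)) = ∅ := by
        refine eq_empty_of_forall_notMem fun x hx => hs ?_
        rw [mem_inter_iff, hmem] at hx
        obtain ⟨⟨h1, h2, _⟩, h3⟩ := hx
        constructor <;> linarith
      rw [this, measure_empty]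
  -- Cavalieri's principle along `v`: the slices contribute ∫₀¹ sⁿ⁻¹ ds = 1/n, and the change of
  -- variable contributes ‖v‖ = 1/‖g‖.
  have key := EuclideanGeometry.euclideanHausdorffMeasure_eq_lintegral (b k) hv0
    (measurableSet_cone b k hB)
  rw [finrank_euclideanSpace_fin, EuclideanSpace.euclideanHausdorffMeasure_eq_volume] at key
  rw [key]
  simp_rw [hslice]
  rw [lintegral_indicator measurableSet_Ioc, lintegral_mul_const _ (by fun_prop),
    lintegral_Ioc_pow, ← mul_assoc]
  congr 1
  rw [← ofReal_norm, hvn, ← ENNReal.ofReal_mul (by positivity), mul_inv, mul_comm,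
    Nat.cast_sub hn]
  simp

/-- The facet opposite to the vertex `k`. -/
def facet (k : ι) : Set (E n) := {x | b.coord k x = 0 ∧ ∀ i, 0 ≤ b.coord i x}

lemma convexHull_facet (k : ι) : convexHull ℝ (b '' {k}ᶜ) = facet b k := by
  apply Subset.antisymm
  · refine convexHull_min ?_ ?_
    · rintro _ ⟨i, hi, rfl⟩
      refine ⟨b.coord_apply_ne (Ne.symm hi), fun j => ?_⟩
      rw [b.coord_apply]
      split_ifs <;> norm_num
    · have h1 : Convex ℝ (b.coord k ⁻¹' {0}) := (convex_singleton 0).affine_preimage _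
      have h2 : Convex ℝ (⋂ i, b.coord i ⁻¹' Ici 0) :=
        convex_iInter fun i => (convex_Ici 0).affine_preimage _
      have : facet b k = b.coord k ⁻¹' {0} ∩ ⋂ i, b.coord i ⁻¹' Ici 0 := by
        ext x; simp [facet]
      rw [this]
      exact h1.inter h2
  · rintro x ⟨hk, hx⟩
    rw [← b.linear_combination_coord_eq_self x,
      ← Finset.add_sum_erase _ _ (Finset.mem_univ k), hk, zero_smul, zero_add]
    refine (convex_convexHull ℝ _).sum_mem (fun i _ => hx i) ?_ fun i hi => ?_
    · have := b.sum_coord_apply_eq_one x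
      rwa [← Finset.add_sum_erase _ _ (Finset.mem_univ k), hk, zero_add] at this
    · exact subset_convexHull ℝ _ ⟨i, Finset.ne_of_mem_erase hi, rfl⟩

lemma isClosed_facet (k : ι) : IsClosed (facet b k) := by
  rw [← convexHull_facet]
  exact ((toFinite _).image b).isClosed_convexHull ℝ

/-- A point of the simplex other than the apex is projected from the apex onto the facet; only at
the apex is this impossible, as there the coordinate of `b k` is 1. -/
lemma cone_facet (k : ι) : cone b k (facet b k) = convexHull ℝ (range b) \ {b k} := by
  have hco : ∀ (c : ℝ) (x : E n) (i : ι), i ≠ k →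
      b.coord i (AffineMap.homothety (b k) c x) = c * b.coord i x := by
    intro c x i hi
    have h1 : AffineMap.homothety (b k) c x = b k + c • (x - b k) := by
      simp [AffineMap.homothety_apply, add_comm]
    rw [h1, affine_eq _ _ (b k), add_sub_cancel_left, inner_smul_right, affine_eq _ x (b k)]
    simp [hi]
  ext x
  rw [b.convexHull_eq_nonneg_coord]
  constructor
  · rintro ⟨h1, h2, h3, h4⟩
    refine ⟨fun i => ?_, ?_⟩
    · by_cases hi : i = k
      · rwa [hi]
      · have := h4 i
        rw [hco _ _ _ hi] at this
        exact (mul_nonneg_iff_of_pos_left (inv_pos.2 (sub_pos.2 h1))).1 this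
    · rintro rfl
      simp at h1
  · rintro ⟨h1, h2⟩
    have hlt : b.coord k x < 1 := by
      refine lt_of_le_of_ne ?_ fun h => h2 ?_
      · rw [← b.sum_coord_apply_eq_one x]
        exact Finset.single_le_sum (f := fun i => b.coord i x) (fun i _ => h1 i) (Finset.mem_univ k)
      · have hs := b.sum_coord_apply_eq_one x
        rw [← Finset.add_sum_erase _ _ (Finset.mem_univ k), h, add_eq_left,
          Finset.sum_eq_zero_iff_of_nonneg fun i _ => h1 i] at hs
        refine b.ext_elem fun i => ?_
        by_cases hi : i = k
        · rw [hi, h, b.coord_apply_eq]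
        · rw [hs i (Finset.mem_erase.2 ⟨hi, Finset.mem_univ i⟩), b.coord_apply_ne hi]
    refine ⟨hlt, h1 k, ?_, fun i => ?_⟩
    · rw [coord_homothety]
      have : 1 - b.coord k x ≠ 0 := (sub_pos.2 hlt).ne'
      field_simp
      ring
    · by_cases hi : i = k
      · rw [hi, coord_homothety]
        have : 1 - b.coord k x ≠ 0 := (sub_pos.2 hlt).ne'
        apply le_of_eq
        field_simp
        ring
      · rw [hco _ _ _ hi]
        exact mul_nonneg (inv_pos.2 (sub_pos.2 hlt)).le (h1 i)

lemma preimage_swapMap_cone (i j k : ι) (hi : k ≠ i) (hj : k ≠ j) (B : Set (E n)) :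
    swapMap b i j ⁻¹' cone b k B = cone b k (swapMap b i j ⁻¹' B) := by
  ext x
  simp only [cone, mem_preimage, mem_ofPred_eq, coord_swapMap, Equiv.swap_apply_of_ne_of_ne hi hj,
    swapMap_homothety b i j k hi hj]

lemma preimage_swapMap_facet (i j k : ι) (hi : k ≠ i) (hj : k ≠ j) :
    swapMap b i j ⁻¹' facet b k = facet b k := by
  ext x
  simp only [facet, mem_preimage, mem_ofPred_eq, coord_swapMap, Equiv.swap_apply_of_ne_of_ne hi hj]
  exact and_congr_right fun _ => ⟨fun h l => by simpa using h (Equiv.swap i j l), fun h l => h _⟩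

/-- Integrals of affine functions over facets. -/
lemma setIntegral_facet (hn : 1 ≤ n) (hι : Fintype.card ι = n + 1) (k : ι) (v : E n →ᵃ[ℝ] ℝ) :
    ∫ x in facet b k, v x ∂μHE[n - 1] = volume.real (convexHull ℝ (range b)) *
      ‖affGrad (b.coord k)‖ * ∑ i ∈ Finset.univ.erase k, v (b i) := by
  have : Nontrivial ι := Fintype.one_lt_card_iff_nontrivial.1 (by omega)
  have hn0 : (0 : ℝ) < n := by exact_mod_cast hn
  have hgn : 0 < ‖affGrad (b.coord k)‖ := norm_pos_iff.2 (affGrad_coord_ne_zero b k)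
  have hm := (isClosed_facet b k).measurableSet
  set c := ((n : ℝ) * ‖affGrad (b.coord k)‖)⁻¹ with hc
  have hcpos : 0 < c := by positivity
  have hc0 : ENNReal.ofReal c ≠ 0 := by simpa using hcpos
  -- The cone over the facet is the simplex without its apex, and a point is a null set since n ≥ 1.
  -- This also shows that the facet has finite measure.
  have hvol : volume (convexHull ℝ (range b)) = ENNReal.ofReal c * μHE[n - 1] (facet b k) := by
    rw [← volume_cone b hn k hm fun x hx => hx.1, cone_facet]
    have : NullSingletonClass (volume : Measure (E n)) := by
      have : Nontrivial (E n) := by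
        have : Nonempty (Fin n) := ⟨⟨0, hn⟩⟩
        infer_instance
      infer_instance
    exact (measure_sdiff_null (measure_singleton _)).symm
  have hfin : (μHE[n - 1] : Measure (E n)) (facet b k) ≠ ⊤ := by
    intro h
    rw [h, ENNReal.mul_top hc0] at hvol
    exact measure_convexHull_ne_top b hvol
  have hreal : volume.real (convexHull ℝ (range b)) =
      c * (μHE[n - 1] : Measure (E n)).real (facet b k) := by
    rw [measureReal_def, hvol, ENNReal.toReal_mul, ENNReal.toReal_ofReal hcpos.le, measureReal_def]
  have h := (setIntegral_coord_of_invariant b (μ := μHE[n - 1]) (s := facet b k)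
    (Finset.univ.erase k) (fun x hx => hx.2) ?_ hm hfin ?_ v).2
  · rw [Finset.card_erase_of_mem (Finset.mem_univ k), Finset.card_univ, hι, Nat.add_sub_cancel] at h
    rw [hreal]
    have hcn : c * ‖affGrad (b.coord k)‖ = (n : ℝ)⁻¹ := by
      rw [hc]; field_simp
    calc _ = (n : ℝ)⁻¹ * ((n : ℝ) * ∫ x in facet b k, v x ∂μHE[n - 1]) := by field_simp
      _ = _ := by rw [h, ← hcn]; ring
  · intro x hx i hi
    have : i = k := by simpa using hi
    rw [this]; exact hx.1
  · intro i hi j hj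
    have hi := (Finset.ne_of_mem_erase hi).symm
    have hj := (Finset.ne_of_mem_erase hj).symm
    -- Swapping two vertices of the facet fixes the apex, so it commutes with taking cones. It
    -- preserves the volumes of cones, hence the surface measure of their bases.
    refine ⟨(continuous_swapMap b i j).measurable, Measure.ext fun s hs => ?_⟩
    have hS := (continuous_swapMap b i j).measurable
    rw [Measure.map_apply hS hs, Measure.restrict_apply (hS hs), Measure.restrict_apply hs,
      ← preimage_swapMap_facet b i j k hi hj, ← preimage_inter, preimage_swapMap_facet b i j k hi hj]
    have e1 := volume_cone b hn k (hs.inter hm) fun x hx => hx.2.1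
    have e2 := volume_cone b hn k (hS (hs.inter hm)) fun x hx => by
      have := hx.2.1
      rwa [coord_swapMap, Equiv.swap_apply_of_ne_of_ne hi hj] at this
    rw [← preimage_swapMap_cone b i j k hi hj, (measurePreserving_swapMap b i j).measure_preimage
      (measurableSet_cone b k (hs.inter hm)).nullMeasurableSet, e1] at e2
    exact ((ENNReal.mul_right_inj hc0 ENNReal.ofReal_ne_top).1 e2).symm

end SimplexIntegrals

namespace Triangulation

variable {n : ℕ} {Ω : Set (E n)} (Tri : Triangulation n Ω)

/-! ### Cells -/

/-- The vertices of a cell as an affine basis. -/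
def cellBasis (T : Tri.cells) : AffineBasis {z // z ∈ T.1} ℝ (E n) where
  toFun := Subtype.val
  ind' := Tri.affineIndependent_cell T.1 T.2
  tot' := by
    rw [(Tri.affineIndependent_cell T.1 T.2).affineSpan_eq_top_iff_card_eq_finrank_add_one]
    simp [Tri.card_cell T.1 T.2]

@[simp] lemma cellBasis_apply (T : Tri.cells) (z : {z // z ∈ T.1}) : Tri.cellBasis T z = z := rfl

lemma range_cellBasis (T : Tri.cells) : range (Tri.cellBasis T) = (T.1 : Set (E n)) := by
  ext x; simp

lemma card_vertices (T : Tri.cells) : Fintype.card {z // z ∈ T.1} = n + 1 := by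
  simp [Tri.card_cell T.1 T.2]

lemma hull_eq (T : Tri.cells) : hull T.1 = convexHull ℝ (range (Tri.cellBasis T)) := by
  rw [range_cellBasis]

lemma mem_hull (T : Tri.cells) (x : E n) : x ∈ hull T.1 ↔ ∀ i, 0 ≤ (Tri.cellBasis T).coord i x := by
  rw [hull_eq, AffineBasis.convexHull_eq_nonneg_coord]; rfl

lemma mem_interior_hull (T : Tri.cells) (x : E n) :
    x ∈ interior (hull T.1) ↔ ∀ i, 0 < (Tri.cellBasis T).coord i x := by
  rw [hull_eq, AffineBasis.interior_convexHull]; rfl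

lemma volume_hull_ne_top (T : Finset (E n)) : volume (hull T) ≠ ⊤ :=
  (T.finite_toSet.isCompact_convexHull ℝ).measure_lt_top.ne

lemma interior_ae_eq_hull (T : Finset (E n)) : interior (hull T) =ᵐ[volume] hull T :=
  interior_ae_eq_of_null_frontier ((convex_convexHull ℝ _).addHaar_frontier _)

/-- The volume of a cell. -/
def cellVol (T : Tri.cells) : ℝ := volume.real (hull T.1)

lemma cellVol_pos (T : Tri.cells) : 0 < Tri.cellVol T := by
  refine ENNReal.toReal_pos ?_ (volume_hull_ne_top _)
  rw [← measure_congr (interior_ae_eq_hull T.1)]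
  refine (isOpen_interior.measure_pos _ ?_).ne'
  have := (Tri.cellBasis T).centroid_mem_interior_convexHull
  rw [← hull_eq] at this
  exact ⟨_, this⟩

/-- Distinct cells share at most n vertices, and they meet in the hull of these. Its affine span has
dimension less than n, so the intersection has empty interior. -/
lemma disjoint_interior {S T : Tri.cells} (h : S ≠ T) :
    Disjoint (interior (hull S.1)) (interior (hull T.1)) := by
  classical
  rw [disjoint_iff_inter_eq_empty, ← not_nonempty_iff_eq_empty, ← interior_inter]
  intro hne
  rw [Tri.inter_cell S.1 S.2 T.1 T.2, interior_convexHull_nonempty_iff_affineSpan_eq_top,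
    ← Finset.coe_inter] at hne
  have hlt : (S.1 ∩ T.1).card < n + 1 := by
    rw [← Tri.card_cell S.1 S.2]
    refine Finset.card_lt_card (Finset.inter_subset_left.ssubset_of_ne fun he => h ?_)
    refine Subtype.ext (Finset.eq_of_subset_of_card_le (Finset.inter_eq_left.1 he) ?_)
    rw [Tri.card_cell S.1 S.2, Tri.card_cell T.1 T.2]
  have hne' : (S.1 ∩ T.1 : Finset (E n)).Nonempty := by
    rw [Finset.nonempty_iff_ne_empty]
    intro h0
    rw [h0] at hne
    simp at hne
  have h1 := finrank_vectorSpan_image_finset_le ℝ (id : E n → E n) (S.1 ∩ T.1)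
    (n := (S.1 ∩ T.1).card - 1) (by have := hne'.card_pos; omega)
  rw [Finset.image_id, ← direction_affineSpan, hne, AffineSubspace.direction_top, finrank_top,
    finrank_euclideanSpace_fin] at h1
  have := hne'.card_pos
  omega

lemma interior_hull_subset (hΩ : interior (closure Ω) = Ω) (T : Tri.cells) :
    interior (hull T.1) ⊆ Ω := by
  refine (interior_mono ?_).trans hΩ.subset
  rw [← Tri.cover]
  exact subset_biUnion_of_mem (u := fun T : Finset (E n) => convexHull ℝ (T : Set (E n))) T.2

/-- Ω lies between the union of the open cells and the union of the closed ones, which is its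
closure. The two unions differ by a null set because the frontier of a convex set is null. -/
lemma ae_eq_iUnion (hΩ : interior (closure Ω) = Ω) :
    Ω =ᵐ[volume] ⋃ T : Tri.cells, interior (hull T.1) := by
  have h1 : (⋃ T : Tri.cells, interior (hull T.1)) =ᵐ[volume] ⋃ T : Tri.cells, hull T.1 :=
    Filter.EventuallyEq.countable_iUnion fun T => interior_ae_eq_hull T.1
  have h2 : (⋃ T : Tri.cells, hull T.1) = closure Ω := by
    rw [← Tri.cover, iUnion_subtype]
  rw [h2] at h1
  refine (subset_closure.eventuallyLE.trans h1.symm.le).antisymm ?_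
  exact (iUnion_subset (Tri.interior_hull_subset hΩ)).eventuallyLE

lemma glue_apply {V : Type*} [AddCommMonoid V] (v : Tri.cells → E n → V) {T : Tri.cells} {x : E n}
    (hx : x ∈ interior (hull T.1)) : Tri.glue v x = v T x := by
  classical
  rw [glue, Finset.sum_eq_single T, indicator_of_mem hx]
  · intro S _ hS
    exact indicator_of_notMem (fun h => (Tri.disjoint_interior hS).le_bot ⟨h, hx⟩) _
  · exact fun h => absurd (Finset.mem_univ T) h

lemma ae_mem_cell (hΩ : interior (closure Ω) = Ω) :
    ∀ᵐ x ∂volume.restrict Ω, ∃ T : Tri.cells, x ∈ interior (hull T.1) := by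
  rw [Measure.restrict_congr_set (Tri.ae_eq_iUnion hΩ)]
  refine (ae_restrict_iff' (MeasurableSet.iUnion fun T => isOpen_interior.measurableSet)).2 ?_
  exact .of_forall fun x hx => mem_iUnion.1 hx

lemma ae_of_ae_cell (hΩ : interior (closure Ω) = Ω) {P : E n → Prop}
    (h : ∀ T : Tri.cells, ∀ᵐ x ∂volume, x ∈ interior (hull T.1) → P x) :
    ∀ᵐ x ∂volume.restrict Ω, P x := by
  have h' : ∀ᵐ x ∂volume.restrict Ω, ∀ T : Tri.cells, x ∈ interior (hull T.1) → P x :=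
    ae_restrict_of_ae (ae_all_iff.2 h)
  filter_upwards [h', Tri.ae_mem_cell hΩ] with x hx ⟨T, hT⟩ using hx T hT

/-- Integrals over `Ω` of piecewise given functions. -/
lemma setIntegral_eq_sum (hΩ : interior (closure Ω) = Ω) {V : Type*} [NormedAddCommGroup V]
    [NormedSpace ℝ V] {G : E n → V} {G' : Tri.cells → E n → V}
    (h : ∀ᵐ x ∂volume.restrict Ω, ∀ T : Tri.cells, x ∈ interior (hull T.1) → G x = G' T x)
    (hi : ∀ T, IntegrableOn (G' T) (hull T.1)) :
    IntegrableOn G Ω ∧ ∫ x in Ω, G x = ∑ T, ∫ x in hull T.1, G' T x := by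
  have hm : ∀ T : Tri.cells, MeasurableSet (interior (hull T.1)) :=
    fun T => isOpen_interior.measurableSet
  have hae : ∀ T : Tri.cells, G' T =ᵐ[volume.restrict (interior (hull T.1))] G := by
    intro T
    have := ae_restrict_of_ae_restrict_of_subset (Tri.interior_hull_subset hΩ T) h
    filter_upwards [this, ae_restrict_mem (hm T)] with x hx hxT using (hx T hxT).symm
  have hI : ∀ T : Tri.cells, IntegrableOn G (interior (hull T.1)) := fun T =>
    ((hi T).mono_set interior_subset).congr (hae T)
  rw [IntegrableOn, Measure.restrict_congr_set (Tri.ae_eq_iUnion hΩ)]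
  refine ⟨integrableOn_finite_iUnion.2 hI, ?_⟩
  rw [integral_iUnion_fintype hm (fun S T hST => Tri.disjoint_interior hST) hI]
  refine Finset.sum_congr rfl fun T _ => ?_
  rw [← Measure.restrict_congr_set (interior_ae_eq_hull T.1)]
  exact (integral_congr_ae (hae T)).symm

lemma affine_mid (T : Tri.cells) (v : E n →ᵃ[ℝ] ℝ) :
    v (Tri.mid T) = ((n : ℝ) + 1)⁻¹ * ∑ z : {z // z ∈ T.1}, v z := by
  have hn : ((n : ℝ) + 1) ≠ 0 := by positivity
  have h2 : ∑ z : {z // z ∈ T.1}, v z = ((n : ℝ) + 1) * v 0 + inner ℝ (affGrad v) (∑ z ∈ T.1, z) := by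
    have : ∀ z : {z // z ∈ T.1}, v z = v 0 + inner ℝ (affGrad v) (z : E n) := fun z => by
      rw [affine_eq v z 0, sub_zero]
    simp_rw [this]
    rw [Finset.sum_add_distrib, ← inner_sum, Finset.sum_coe_sort T.1 fun z => z]
    simp [Tri.card_cell T.1 T.2]
  rw [h2, affine_eq v (Tri.mid T) 0, mid, sub_zero, inner_smul_right]
  field_simp

/-- The midpoint rule: by symmetry the mean of an affine function is the average of its n + 1 vertex
values, which is its value at the barycenter. -/
lemma setIntegral_cell (T : Tri.cells) (v : E n →ᵃ[ℝ] ℝ) :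
    IntegrableOn (fun x => v x) (hull T.1) ∧
      ∫ x in hull T.1, v x = Tri.cellVol T * v (Tri.mid T) := by
  classical
  have hn : ((n : ℝ) + 1) ≠ 0 := by positivity
  have h := setIntegral_simplex (Tri.cellBasis T) v
  rw [← hull_eq, card_vertices] at h
  refine ⟨h.1, ?_⟩
  rw [affine_mid, cellVol]
  have h2 := h.2
  push_cast at h2
  simp only [cellBasis_apply] at h2
  field_simp
  linarith

/-! ### Sides and normals -/

lemma mem_sidesOf {T : Tri.cells} {F : Tri.sides} : F ∈ Tri.sidesOf T ↔ F.1 ⊆ T.1 := by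
  simp [sidesOf]

lemma card_side (F : Tri.sides) : F.1.card = n := by
  have := F.2
  simp only [sides, Finset.mem_biUnion, Finset.mem_powersetCard] at this
  obtain ⟨T, _, _, h⟩ := this
  exact h

lemma exists_opposite (T : Tri.cells) (F : Tri.sides) :
    ∃ z : {z // z ∈ T.1}, z.1 ∉ F.1 := by
  by_contra! hc
  have := Finset.card_le_card (show T.1 ⊆ F.1 from fun z hz => hc ⟨z, hz⟩)
  rw [Tri.card_cell T.1 T.2, card_side] at this
  omega

lemma mem_side_iff {T : Tri.cells} {F : Tri.sides} (h : F ∈ Tri.sidesOf T) {z : {z // z ∈ T.1}}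
    (hz : z.1 ∉ F.1) (w : {z // z ∈ T.1}) : w.1 ∈ F.1 ↔ w ≠ z := by
  classical
  rw [mem_sidesOf] at h
  have : F.1 = T.1.erase z.1 := by
    refine Finset.eq_of_subset_of_card_le (fun x hx => Finset.mem_erase.2 ⟨?_, h hx⟩) ?_
    · rintro rfl; exact hz hx
    · rw [Finset.card_erase_of_mem z.2, Tri.card_cell T.1 T.2, card_side]; simp
  rw [this, Finset.mem_erase]
  exact ⟨fun h he => h.1 (congrArg _ he), fun h => ⟨fun he => h (Subtype.ext he), w.2⟩⟩

/-- Each side of a simplex omits exactly one vertex, and each vertex is omitted by exactly one side.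
-/
lemma sum_sidesOf (T : Tri.cells) (h : Tri.sides → ℝ) (h' : {z // z ∈ T.1} → ℝ)
    (H : ∀ F ∈ Tri.sidesOf T, ∀ z : {z // z ∈ T.1}, z.1 ∉ F.1 → h F = h' z) :
    ∑ F ∈ Tri.sidesOf T, h F = ∑ z, h' z := by
  classical
  have hex : ∀ F : Tri.sides, F ∈ Tri.sidesOf T → ∃ z : {z // z ∈ T.1}, z.1 ∉ F.1 :=
    fun F _ => Tri.exists_opposite T F
  choose z hz using hex
  refine Finset.sum_bij z (fun _ _ => Finset.mem_univ _) ?_ ?_ fun F hF => H F hF _ (hz F hF)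
  · intro F hF G hG he
    refine Subtype.ext (Finset.ext fun x => ?_)
    have h1 := Tri.mem_side_iff hF (hz F hF)
    have h2 := Tri.mem_side_iff hG (hz G hG)
    constructor
    · intro hx
      have := (h1 ⟨x, Tri.mem_sidesOf.1 hF hx⟩).1 hx
      rw [he] at this
      exact (h2 _).2 this
    · intro hx
      have := (h2 ⟨x, Tri.mem_sidesOf.1 hG hx⟩).1 hx
      rw [← he] at this
      exact (h1 _).2 this
  · intro w _
    have hF : T.1.erase w.1 ∈ Tri.sides := by
      simp only [sides, Finset.mem_biUnion, Finset.mem_powersetCard]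
      refine ⟨T.1, T.2, Finset.erase_subset _ _, ?_⟩
      rw [Finset.card_erase_of_mem w.2, Tri.card_cell T.1 T.2]; simp
    have hFT : (⟨_, hF⟩ : Tri.sides) ∈ Tri.sidesOf T := Tri.mem_sidesOf.2 (Finset.erase_subset _ _)
    refine ⟨⟨_, hF⟩, hFT, ?_⟩
    have := hz _ hFT
    by_contra hne
    exact this (Finset.mem_erase.2 ⟨fun h => hne (Subtype.ext h), (z _ hFT).2⟩)

lemma hull_side {T : Tri.cells} {F : Tri.sides} (h : F ∈ Tri.sidesOf T) {z : {z // z ∈ T.1}}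
    (hz : z.1 ∉ F.1) : hull F.1 = facet (Tri.cellBasis T) z := by
  rw [← convexHull_facet, hull]
  congr 1
  ext x
  simp only [Finset.mem_coe, mem_image, mem_compl_iff, mem_singleton_iff, cellBasis_apply]
  constructor
  · intro hx
    have hxT := Tri.mem_sidesOf.1 h hx
    exact ⟨⟨x, hxT⟩, (Tri.mem_side_iff h hz ⟨x, hxT⟩).1 hx, rfl⟩
  · rintro ⟨w, hw, rfl⟩
    exact (Tri.mem_side_iff h hz w).2 hw

lemma side_nonempty (hn : 1 ≤ n) (F : Tri.sides) : F.1.Nonempty := by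
  rw [← Finset.card_pos, card_side]; omega

/-- The affine function x ↦ v · (x - x₀) vanishes at every vertex of the side, so in the expansion
of its gradient over the vertices only the opposite vertex contributes. -/
lemma normal_eq_smul {T : Tri.cells} {F : Tri.sides} (h : F ∈ Tri.sidesOf T)
    {z : {z // z ∈ T.1}} (hz : z.1 ∉ F.1) {v : E n}
    (hv : ∀ x ∈ F.1, ∀ y ∈ F.1, inner ℝ v (x - y) = 0) {x₀ : E n} (hx₀ : x₀ ∈ F.1) :
    v = inner ℝ v (z - x₀) • affGrad ((Tri.cellBasis T).coord z) := by
  classical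
  have h1 := affGrad_eq_sum (Tri.cellBasis T) (affOf x₀ 0 v)
  rw [affGrad_affOf, Finset.sum_eq_single z] at h1
  · simpa [affOf_apply] using h1
  · intro w _ hw
    rw [affOf_apply, cellBasis_apply, hv _ ((Tri.mem_side_iff h hz w).2 hw) _ hx₀]
    simp
  · exact fun h => absurd (Finset.mem_univ _) h

lemma affGrad_cell_ne_zero (hn : 1 ≤ n) (T : Tri.cells) (z : {z // z ∈ T.1}) :
    affGrad ((Tri.cellBasis T).coord z) ≠ 0 := by
  classical
  have : Nontrivial {z // z ∈ T.1} := by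
    rw [← Fintype.one_lt_card_iff_nontrivial, card_vertices]; omega
  exact affGrad_coord_ne_zero _ _

lemma coord_side {T : Tri.cells} {F : Tri.sides} (h : F ∈ Tri.sidesOf T) {z : {z // z ∈ T.1}}
    (hz : z.1 ∉ F.1) {x : E n} (hx : x ∈ hull F.1) : (Tri.cellBasis T).coord z x = 0 := by
  rw [Tri.hull_side h hz] at hx
  exact hx.1

lemma isOuterNormal_outerNormal (hn : 1 ≤ n) {T : Tri.cells} {F : Tri.sides}
    (h : F ∈ Tri.sidesOf T) : IsOuterNormal T.1 F.1 (outerNormal T.1 F.1) := by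
  obtain ⟨z, hz⟩ := Tri.exists_opposite T F
  set g := affGrad ((Tri.cellBasis T).coord z) with hg
  have hg0 : 0 < ‖g‖ := norm_pos_iff.2 (Tri.affGrad_cell_ne_zero hn T z)
  have hsub : ∀ x ∈ F.1, x ∈ hull F.1 := fun x hx => subset_convexHull ℝ _ hx
  have key : ∀ x y : E n, inner ℝ (-‖g‖⁻¹ • g) (x - y) =
      -‖g‖⁻¹ * ((Tri.cellBasis T).coord z x - (Tri.cellBasis T).coord z y) := by
    intro x y
    rw [inner_smul_left, affine_eq _ x y, ← hg]
    simp
  -- The coordinate of the opposite vertex is 1 there and 0 on the side, so the outward direction is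
  -- that of its negative gradient.
  refine Classical.epsilon_spec (p := fun v => IsOuterNormal T.1 F.1 v) ⟨-‖g‖⁻¹ • g, ?_, ?_, ?_⟩
  · rw [norm_smul, norm_neg, norm_inv, norm_norm, inv_mul_cancel₀ hg0.ne']
  · intro x hx y hy
    rw [key, Tri.coord_side h hz (hsub x hx), Tri.coord_side h hz (hsub y hy)]
    simp
  · intro w hwT hwF x hx
    have hwz : (⟨w, hwT⟩ : {z // z ∈ T.1}) = z := by
      by_contra hne
      exact hwF ((Tri.mem_side_iff h hz ⟨w, hwT⟩).2 hne)
    have h1 : (Tri.cellBasis T).coord z (z : E n) = 1 := (Tri.cellBasis T).coord_apply_eq z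
    rw [key, show w = z from congrArg Subtype.val hwz, h1, Tri.coord_side h hz (hsub x hx)]
    simpa using hg0

/-- Only length and orthogonality of the normal enter, so `T` need not be the cell that fixes the
orientation; the sign of `c` remains open. -/
lemma orientation_eq_smul (hn : 1 ≤ n) {ν : Tri.sides → E n} (hν : Tri.IsOrientation ν)
    {T : Tri.cells} {F : Tri.sides} (h : F ∈ Tri.sidesOf T) {z : {z // z ∈ T.1}} (hz : z.1 ∉ F.1) :
    ∃ c : ℝ, ν F = c • affGrad ((Tri.cellBasis T).coord z) ∧
      |c| * ‖affGrad ((Tri.cellBasis T).coord z)‖ = 1 := by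
  obtain ⟨x₀, hx₀⟩ := Tri.side_nonempty hn F
  obtain ⟨S, _, hS1, hS2, _⟩ := hν F
  have := Tri.normal_eq_smul h hz hS2 hx₀
  refine ⟨_, this, ?_⟩
  rw [← Real.norm_eq_abs, ← norm_smul, ← this, hS1]

lemma outerNormal_eq_smul (hn : 1 ≤ n) {T : Tri.cells} {F : Tri.sides} (h : F ∈ Tri.sidesOf T)
    {z : {z // z ∈ T.1}} (hz : z.1 ∉ F.1) :
    outerNormal T.1 F.1 = -‖affGrad ((Tri.cellBasis T).coord z)‖⁻¹ •
      affGrad ((Tri.cellBasis T).coord z) := by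
  obtain ⟨x₀, hx₀⟩ := Tri.side_nonempty hn F
  obtain ⟨h1, h2, h3⟩ := Tri.isOuterNormal_outerNormal hn h
  have h4 := Tri.normal_eq_smul h hz h2 hx₀
  have h5 := h3 z z.2 hz x₀ hx₀
  set g := affGrad ((Tri.cellBasis T).coord z)
  set c := inner ℝ (outerNormal T.1 F.1) (z - x₀)
  have hg0 : 0 < ‖g‖ := norm_pos_iff.2 (Tri.affGrad_cell_ne_zero hn T z)
  rw [h4, norm_smul, Real.norm_eq_abs, abs_of_neg h5] at h1
  rw [h4]
  congr 1
  field_simp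
  linarith

/-- The divergence theorem for Raviart-Thomas times affine functions, summed over all cells. -/
lemma bracket_eq (hn : 1 ≤ n) {ν : Tri.sides → E n} (hν : Tri.IsOrientation ν) {q : Tri.RTCoeff}
    {t : Tri.P0Sides} (hq : Tri.HasNormalTrace ν q t) (v : Tri.P1) :
    Tri.bracket ν t v = ∑ T, Tri.cellVol T *
      (inner ℝ (q T).1 (affGrad (v T)) + (n : ℝ) * (q T).2 * v T (Tri.mid T)) := by
  classical
  unfold bracket
  refine Finset.sum_congr rfl fun T _ => ?_
  set b := Tri.cellBasis T with hb
  have hn1 : ((n : ℝ) + 1) ≠ 0 := by positivity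
  have hsumv : ∑ z : {z // z ∈ T.1}, v T z = ((n : ℝ) + 1) * v T (Tri.mid T) := by
    rw [affine_mid]; field_simp
  -- The contribution of the side opposite to `z`: the factor ‖g‖ of the facet integral cancels the
  -- one in the unit normal -g/‖g‖, where g is the gradient of the coordinate of `z`, and the vertex
  -- values on the side sum to (n + 1) v(mid T) - v(z).
  rw [Tri.sum_sidesOf T _ (fun z => -Tri.cellVol T *
    (inner ℝ (q T).1 (affGrad (b.coord z)) - (q T).2 * ((n : ℝ) + 1)⁻¹) *
      (((n : ℝ) + 1) * v T (Tri.mid T) - v T z))]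
  · have e1 : ∑ z : {z // z ∈ T.1}, inner ℝ (q T).1 (affGrad (b.coord z)) = 0 := by
      rw [← inner_sum, sum_affGrad_coord, inner_zero_right]
    have e2 : ∑ z : {z // z ∈ T.1}, v T z * inner ℝ (q T).1 (affGrad (b.coord z)) =
        inner ℝ (q T).1 (affGrad (v T)) := by
      rw [affGrad_eq_sum b (v T), inner_sum]
      simp [inner_smul_right, hb]
    have e3 : ∀ z : {z // z ∈ T.1}, -Tri.cellVol T *
        (inner ℝ (q T).1 (affGrad (b.coord z)) - (q T).2 * ((n : ℝ) + 1)⁻¹) *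
          (((n : ℝ) + 1) * v T (Tri.mid T) - v T z) =
        -(Tri.cellVol T * ((n : ℝ) + 1) * v T (Tri.mid T)) *
            inner ℝ (q T).1 (affGrad (b.coord z)) +
          Tri.cellVol T * (v T z * inner ℝ (q T).1 (affGrad (b.coord z))) +
          Tri.cellVol T * (q T).2 * v T (Tri.mid T) -
          Tri.cellVol T * (q T).2 * ((n : ℝ) + 1)⁻¹ * v T z := by
      intro z; field_simp; ring
    simp_rw [e3]
    rw [Finset.sum_sub_distrib, Finset.sum_add_distrib, Finset.sum_add_distrib, Finset.sum_const,
      ← Finset.mul_sum, ← Finset.mul_sum, ← Finset.mul_sum, e1, e2, hsumv, Finset.card_univ,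
      card_vertices]
    simp only [nsmul_eq_mul]
    push_cast
    field_simp
    ring
  · intro F hF z hz
    obtain ⟨c, hc1, hc2⟩ := Tri.orientation_eq_smul hn hν hF hz
    rw [integral_const_mul, Tri.hull_side hF hz,
      setIntegral_facet b hn (Tri.card_vertices T) z (v T), Tri.outerNormal_eq_smul hn hF hz]
    rw [← hb] at hc1 hc2 ⊢
    set g := affGrad (b.coord z) with hg
    have hg0 : 0 < ‖g‖ := norm_pos_iff.2 (Tri.affGrad_cell_ne_zero hn T z)
    obtain ⟨x₀, hx₀⟩ := Tri.side_nonempty hn F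
    have hx₀' : x₀ ∈ hull F.1 := subset_convexHull ℝ _ hx₀
    have ht := hq T F hF x₀ hx₀'
    have hmid : b.coord z (Tri.mid T) = ((n : ℝ) + 1)⁻¹ := by
      rw [affine_mid, Finset.sum_eq_single z]
      · have := b.coord_apply_eq z
        rw [hb, cellBasis_apply] at this
        rw [hb, this, mul_one]
      · intro w _ hw
        have := b.coord_apply_ne hw.symm
        rwa [hb, cellBasis_apply] at this
      · exact fun h => absurd (Finset.mem_univ _) h
    have hgx : inner ℝ g (x₀ - Tri.mid T) = -((n : ℝ) + 1)⁻¹ := by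
      have := affine_eq (b.coord z) x₀ (Tri.mid T)
      rw [Tri.coord_side hF hz hx₀', hmid, ← hg] at this
      linarith
    have hqg : inner ℝ (q.onCell T x₀) g =
        inner ℝ (q T).1 g - (q T).2 * ((n : ℝ) + 1)⁻¹ := by
      rw [RTCoeff.onCell, inner_add_left, inner_smul_left, real_inner_comm g (x₀ - _), hgx]
      simp
      ring
    have hS : ∑ i ∈ Finset.univ.erase z, v T (b i) = ((n : ℝ) + 1) * v T (Tri.mid T) - v T z := by
      rw [← hsumv, ← Finset.add_sum_erase _ _ (Finset.mem_univ z)]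
      simp [hb]
    rw [← hull_eq, hS, ← ht, hc1, inner_smul_right, inner_smul_left, inner_smul_right, hqg,
      real_inner_self_eq_norm_sq, ← cellVol]
    -- The chosen normal occurs twice, in ν_T · ν_F and in q · ν_F, so its sign cancels.
    have hcc : c * c * (‖g‖ * ‖g‖) = 1 := by
      have := congrArg (fun x => x * x) hc2
      simp only [mul_one] at this
      rw [← this, ← abs_mul_abs_self c]
      ring
    simp only [conj_trivial]
    generalize inner ℝ (q T).1 g - (q T).2 * ((n : ℝ) + 1)⁻¹ = R
    generalize ((n : ℝ) + 1) * v T (Tri.mid T) - v T z = S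
    field_simp
    linear_combination (-(R * Tri.cellVol T * S)) * hcc

end Triangulation

/-! ### Integration by parts against test functions -/

section TestFunctions

variable {n : ℕ} {Ω : Set (E n)} {χ : E n → ℝ}

namespace IsTestFunction

lemma contDiff_one (h : IsTestFunction Ω χ) : ContDiff ℝ 1 χ := h.1.of_le (by exact_mod_cast le_top)

lemma continuous (h : IsTestFunction Ω χ) : Continuous χ := h.1.continuous

lemma differentiable (h : IsTestFunction Ω χ) : Differentiable ℝ χ :=
  h.contDiff_one.differentiable one_ne_zero

lemma continuous_fderiv (h : IsTestFunction Ω χ) (e : E n) : Continuous fun x => fderiv ℝ χ x e :=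
  (h.contDiff_one.continuous_fderiv one_ne_zero).clm_apply continuous_const

lemma hasCompactSupport_fderiv (h : IsTestFunction Ω χ) (e : E n) :
    HasCompactSupport fun x => fderiv ℝ χ x e :=
  (h.2.1.fderiv (𝕜 := ℝ)).comp_left (g := fun L : E n →L[ℝ] ℝ => L e) rfl

lemma continuous_gradient (h : IsTestFunction Ω χ) : Continuous (gradient χ) :=
  (LinearIsometryEquiv.continuous _).comp (h.contDiff_one.continuous_fderiv one_ne_zero)

lemma hasCompactSupport_gradient (h : IsTestFunction Ω χ) : HasCompactSupport (gradient χ) :=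
  (h.2.1.fderiv (𝕜 := ℝ)).comp_left (g := (InnerProductSpace.toDual ℝ (E n)).symm) (map_zero _)

lemma eq_zero (h : IsTestFunction Ω χ) {x : E n} (hx : x ∉ Ω) : χ x = 0 :=
  image_eq_zero_of_notMem_tsupport fun hx' => hx (h.2.2 hx')

lemma gradient_eq_zero (h : IsTestFunction Ω χ) {x : E n} (hx : x ∉ Ω) : gradient χ x = 0 := by
  have : fderiv ℝ χ x = 0 := by
    by_contra hne
    exact hx (h.2.2 (support_fderiv_subset ℝ hne))
  rw [gradient, this, map_zero]

lemma mono (h : IsTestFunction Ω χ) {Ω' : Set (E n)} (hs : Ω ⊆ Ω') : IsTestFunction Ω' χ :=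
  ⟨h.1, h.2.1, h.2.2.trans hs⟩

lemma memLp (h : IsTestFunction Ω χ) (μ : Measure (E n)) [IsFiniteMeasureOnCompacts μ] :
    MemLp χ 2 μ := h.continuous.memLp_of_hasCompactSupport h.2.1

lemma memLp_gradient (h : IsTestFunction Ω χ) (μ : Measure (E n)) [IsFiniteMeasureOnCompacts μ] :
    MemLp (gradient χ) 2 μ :=
  h.continuous_gradient.memLp_of_hasCompactSupport h.hasCompactSupport_gradient

lemma integral_affine_mul_fderiv (h : IsTestFunction Ω χ) (v : E n →ᵃ[ℝ] ℝ) (e : E n) :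
    Integrable (fun x => v x * fderiv ℝ χ x e) ∧
    ∫ x, v x * fderiv ℝ χ x e = -∫ x, inner ℝ (affGrad v) e * χ x := by
  have hv := continuous_affine v
  have i2 : Integrable (fun x => v x * fderiv ℝ χ x e) :=
    (hv.mul (h.continuous_fderiv e)).integrable_of_hasCompactSupport
      (h.hasCompactSupport_fderiv e).mul_left
  refine ⟨i2, ?_⟩
  have := integral_mul_fderiv_eq_neg_fderiv_mul_of_integrable (μ := (volume : Measure (E n)))
    (f := fun x => v x) (g := χ) (v := e) ?_ i2 ?_
    (fun x _ => (hasFDerivAt_affine v x).differentiableAt)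
    fun x _ => h.differentiable x
  · simpa only [fderiv_affine] using this
  · simp only [fderiv_affine]
    exact (h.continuous.integrable_of_hasCompactSupport h.2.1).const_mul _
  · exact (hv.mul h.continuous).integrable_of_hasCompactSupport h.2.1.mul_left

lemma integral_affine_smul_gradient (h : IsTestFunction Ω χ) (v : E n →ᵃ[ℝ] ℝ) :
    ∫ x, v x • gradient χ x = -∫ x, χ x • affGrad v := by
  refine ext_inner_left ℝ fun e => ?_
  have i1 : Integrable fun x => v x • gradient χ x :=
    ((continuous_affine v).smul h.continuous_gradient).integrable_of_hasCompactSupport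
      h.hasCompactSupport_gradient.smul_left
  have i2 : Integrable fun x => χ x • affGrad v :=
    (h.continuous.integrable_of_hasCompactSupport h.2.1).smul_const _
  rw [inner_neg_right, ← integral_inner i1, ← integral_inner i2]
  have := (h.integral_affine_mul_fderiv v e).2
  simp_rw [inner_smul_right, inner_gradient_right]
  simp only [conj_trivial]
  rw [this]
  congr 2
  ext x
  rw [real_inner_comm, mul_comm]

lemma inner_radial_gradient (A m : E n) (β : ℝ) (x : E n) : inner ℝ (A + β • (x - m)) (gradient χ x) =
      ∑ i : Fin n, affOf m (inner ℝ A (EuclideanSpace.basisFun (Fin n) ℝ i))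
        (β • EuclideanSpace.basisFun (Fin n) ℝ i) x *
          fderiv ℝ χ x (EuclideanSpace.basisFun (Fin n) ℝ i) := by
  rw [inner_gradient_right]
  simp only [conj_trivial]
  conv_lhs => rw [← (EuclideanSpace.basisFun (Fin n) ℝ).sum_repr (A + β • (x - m)), map_sum]
  refine Finset.sum_congr rfl fun i _ => ?_
  rw [map_smul, smul_eq_mul, affOf_apply, OrthonormalBasis.repr_apply_apply, inner_add_right,
    inner_smul_right, inner_smul_left, real_inner_comm A]
  simp

/-- The field has affine components and divergence nβ; each component is integrated by parts
separately. -/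
lemma integral_radial_inner_gradient (h : IsTestFunction Ω χ) (A m : E n) (β : ℝ) :
    Integrable (fun x => inner ℝ (A + β • (x - m)) (gradient χ x)) ∧
    ∫ x, inner ℝ (A + β • (x - m)) (gradient χ x) = -∫ x, ((n : ℝ) * β) * χ x := by
  simp_rw [inner_radial_gradient]
  refine ⟨integrable_finsetSum _ fun i _ => (h.integral_affine_mul_fderiv _ _).1, ?_⟩
  rw [integral_finsetSum _ fun i _ => (h.integral_affine_mul_fderiv _ _).1]
  simp_rw [(h.integral_affine_mul_fderiv _ _).2, affGrad_affOf, inner_smul_left,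
    integral_const_mul]
  simp [mul_assoc]

end IsTestFunction

lemma IsWeakGradient.add_const_smul {u w : E n → ℝ} {g k : E n → E n} (hu : IsWeakGradient Ω u g)
    (hw : IsWeakGradient Ω w k) (hu2 : MemLp u 2 (volume.restrict Ω))
    (hw2 : MemLp w 2 (volume.restrict Ω)) (δ : ℝ) :
    IsWeakGradient Ω (fun x => u x + δ * w x) fun x => g x + δ • k x := by
  refine ⟨hu.1.add (hw.1.const_smul δ), fun χ h => ?_⟩
  have hi : ∀ v : E n → ℝ, MemLp v 2 (volume.restrict Ω) →
      Integrable (fun x => v x • gradient χ x) (volume.restrict Ω) := fun v hv =>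
    memLp_one_iff_integrable.1 ((h.memLp_gradient _).smul hv)
  have hj : ∀ v : E n → E n, MemLp v 2 (volume.restrict Ω) →
      Integrable (fun x => χ x • v x) (volume.restrict Ω) := fun v hv =>
    memLp_one_iff_integrable.1 (hv.smul (h.memLp _))
  simp_rw [add_smul, smul_add, mul_smul, smul_comm _ δ]
  have e1 : Integrable (fun x => δ • w x • gradient χ x) (volume.restrict Ω) := (hi w hw2).smul δ
  have e2 : Integrable (fun x => δ • χ x • k x) (volume.restrict Ω) := (hj k hw.1).smul δ
  rw [integral_add (hi u hu2) e1, integral_add (hj g hu.1) e2,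
    integral_smul, integral_smul, hu.2 χ h, hw.2 χ h, smul_neg, neg_add]

lemma IsWeakDivergence.add_const_smul {u w : E n → E n} {g k : E n → ℝ} (hu : IsWeakDivergence Ω u g)
    (hw : IsWeakDivergence Ω w k) (hu2 : MemLp u 2 (volume.restrict Ω))
    (hw2 : MemLp w 2 (volume.restrict Ω)) (δ : ℝ) :
    IsWeakDivergence Ω (fun x => u x + δ • w x) fun x => g x + δ * k x := by
  refine ⟨hu.1.add (hw.1.const_mul δ), fun χ h => ?_⟩
  have hi : ∀ v : E n → E n, MemLp v 2 (volume.restrict Ω) →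
      Integrable (fun x => inner ℝ (v x) (gradient χ x)) (volume.restrict Ω) := fun v hv =>
    memLp_one_iff_integrable.1 ((innerSL ℝ).memLp_of_bilin 1 hv (h.memLp_gradient _))
  have hj : ∀ v : E n → ℝ, MemLp v 2 (volume.restrict Ω) →
      Integrable (fun x => v x * χ x) (volume.restrict Ω) := fun v hv =>
    hv.integrable_mul (h.memLp _)
  simp_rw [inner_add_left, inner_smul_left, add_mul, mul_assoc]
  simp only [conj_trivial]
  rw [integral_add (hi u hu2) ((hi w hw2).const_mul δ),
    integral_add (hj g hu.1) ((hj k hw.1).const_mul δ),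
    integral_const_mul, integral_const_mul, hu.2 χ h, hw.2 χ h]
  ring

end TestFunctions

/-! ### Weak derivatives of piecewise polynomials -/

namespace Triangulation

variable {n : ℕ} {Ω : Set (E n)} (Tri : Triangulation n Ω)

lemma gradNC_apply (v : Tri.P1) {T : Tri.cells} {x : E n} (hx : x ∈ interior (hull T.1)) :
    v.gradNC x = affGrad (v T) := by
  rw [P1.gradNC, Tri.glue_apply _ hx, gradient_affine]

/-- The piecewise divergence. -/
def divNC (q : Tri.RTCoeff) : E n → ℝ := Tri.glue fun T _ => (n : ℝ) * (q T).2

lemma integrableOn_cell (hΩ : interior (closure Ω) = Ω) (T : Tri.cells) {V : Type*}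
    [NormedAddCommGroup V] {g : E n → V} (hg : MemLp g 2 (volume.restrict Ω)) :
    IntegrableOn g (hull T.1) := by
  rw [IntegrableOn, ← Measure.restrict_congr_set (interior_ae_eq_hull T.1)]
  have hfin : IsFiniteMeasure (volume.restrict (interior (hull T.1))) :=
    ⟨by simpa using (measure_mono interior_subset).trans_lt (volume_hull_ne_top T.1).lt_top⟩
  exact (hg.mono_measure (Measure.restrict_mono (Tri.interior_hull_subset hΩ T) le_rfl)).integrable
    one_le_two

/-- Test functions supported in one open cell see only one affine function. The fundamental lemma of
the calculus of variations identifies the weak gradient there, and the open cells cover Ω up to a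
null set. -/
lemma isWeakGradient_ae (hΩ : interior (closure Ω) = Ω) {u : Tri.P1} {g : E n → E n}
    (hg : IsWeakGradient Ω u.toFun g) : g =ᵐ[volume.restrict Ω] u.gradNC := by
  refine Tri.ae_of_ae_cell hΩ fun T => ?_
  have hsub := Tri.interior_hull_subset hΩ T
  have hint := (Tri.integrableOn_cell hΩ T hg.1).mono_set interior_subset
  have hc : IntegrableOn (fun _ => affGrad (u T)) (interior (hull T.1)) :=
    integrableOn_const ((measure_mono interior_subset).trans_lt
      (volume_hull_ne_top T.1).lt_top).ne
  have key := IsOpen.ae_eq_zero_of_integral_contDiff_smul_eq_zero (μ := volume)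
    (isOpen_interior (s := hull T.1)) (f := fun x => g x - affGrad (u T))
    (hint.sub hc).locallyIntegrableOn ?_
  · filter_upwards [key] with x hx hxT
    rw [Tri.gradNC_apply u hxT, ← sub_eq_zero]
    exact hx hxT
  · intro χ h1 h2 h3
    have hχ : IsTestFunction (interior (hull T.1)) χ := ⟨h1, h2, h3⟩
    have hχΩ := hχ.mono hsub
    have e1 := hg.2 χ hχΩ
    -- The gradient of χ vanishes off the cell, so the affine function may be extended to the whole
    -- space before integrating by parts.
    have e2 : (fun x => u.toFun x • gradient χ x) = fun x => u T x • gradient χ x := by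
      ext1 x
      by_cases hx : x ∈ interior (hull T.1)
      · rw [P1.toFun, Tri.glue_apply _ hx]
      · rw [hχ.gradient_eq_zero hx, smul_zero, smul_zero]
    rw [e2, setIntegral_eq_integral_of_forall_compl_eq_zero
        (fun x hx => by rw [hχΩ.gradient_eq_zero hx, smul_zero]),
      hχ.integral_affine_smul_gradient, neg_inj] at e1
    have hz : ∀ x, x ∉ Ω → χ x • g x = 0 := fun x hx => by rw [hχΩ.eq_zero hx, zero_smul]
    simp_rw [smul_sub]
    have hi : Integrable fun x => χ x • g x := by
      have : IntegrableOn (fun x => χ x • g x) Ω :=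
        memLp_one_iff_integrable.1 (hg.1.smul (hχ.memLp _))
      exact (integrableOn_iff_integrable_of_support_subset fun x hx => by
        by_contra hxΩ; exact hx (hz x hxΩ)).1 this
    rw [integral_sub hi ((hχ.continuous.integrable_of_hasCompactSupport hχ.2.1).smul_const _), e1,
      setIntegral_eq_integral_of_forall_compl_eq_zero hz, sub_self]

lemma isWeakDivergence_ae (hΩ : interior (closure Ω) = Ω) {q : Tri.RTCoeff} {d : E n → ℝ}
    (hd : IsWeakDivergence Ω q.toFun d) : d =ᵐ[volume.restrict Ω] Tri.divNC q := by
  refine Tri.ae_of_ae_cell hΩ fun T => ?_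
  have hsub := Tri.interior_hull_subset hΩ T
  have hint := (Tri.integrableOn_cell hΩ T hd.1).mono_set interior_subset
  have hc : IntegrableOn (fun _ => (n : ℝ) * (q T).2) (interior (hull T.1)) :=
    integrableOn_const ((measure_mono interior_subset).trans_lt
      (volume_hull_ne_top T.1).lt_top).ne
  have key := IsOpen.ae_eq_zero_of_integral_contDiff_smul_eq_zero (μ := volume)
    (isOpen_interior (s := hull T.1)) (f := fun x => d x - (n : ℝ) * (q T).2)
    (hint.sub hc).locallyIntegrableOn ?_
  · filter_upwards [key] with x hx hxT
    rw [divNC, Tri.glue_apply _ hxT, ← sub_eq_zero]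
    exact hx hxT
  · intro χ h1 h2 h3
    have hχ : IsTestFunction (interior (hull T.1)) χ := ⟨h1, h2, h3⟩
    have hχΩ := hχ.mono hsub
    have e1 := hd.2 χ hχΩ
    have e2 : (fun x => inner ℝ (q.toFun x) (gradient χ x)) =
        fun x => inner ℝ ((q T).1 + (q T).2 • (x - Tri.mid T)) (gradient χ x) := by
      ext1 x
      by_cases hx : x ∈ interior (hull T.1)
      · rw [RTCoeff.toFun, Tri.glue_apply _ hx, RTCoeff.onCell]
      · rw [hχ.gradient_eq_zero hx, inner_zero_right, inner_zero_right]
    have hz : ∀ x, x ∉ Ω → d x * χ x = 0 := fun x hx => by rw [hχΩ.eq_zero hx, mul_zero]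
    rw [e2, setIntegral_eq_integral_of_forall_compl_eq_zero
        (fun x hx => by rw [hχΩ.gradient_eq_zero hx, inner_zero_right]),
      (hχ.integral_radial_inner_gradient _ _ _).2, neg_inj,
      setIntegral_eq_integral_of_forall_compl_eq_zero hz] at e1
    simp_rw [smul_eq_mul, mul_sub, mul_comm (χ _)]
    have hi : Integrable fun x => d x * χ x := by
      have : IntegrableOn (fun x => d x * χ x) Ω := hd.1.integrable_mul (hχ.memLp _)
      exact (integrableOn_iff_integrable_of_support_subset fun x hx => by
        by_contra hxΩ; exact hx (hz x hxΩ)).1 this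
    rw [integral_sub hi ((hχ.continuous.integrable_of_hasCompactSupport hχ.2.1).const_mul _), e1,
      sub_self]

lemma weakGrad_ae (hΩ : interior (closure Ω) = Ω) {u : Tri.P1}
    (hu : ∃ g, IsWeakGradient Ω u.toFun g) :
    weakGrad Ω u.toFun =ᵐ[volume.restrict Ω] u.gradNC :=
  Tri.isWeakGradient_ae hΩ (Classical.epsilon_spec hu)

lemma weakDiv_ae (hΩ : interior (closure Ω) = Ω) {q : Tri.RTCoeff}
    (hq : ∃ d, IsWeakDivergence Ω q.toFun d) :
    weakDiv Ω q.toFun =ᵐ[volume.restrict Ω] Tri.divNC q :=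
  Tri.isWeakDivergence_ae hΩ (Classical.epsilon_spec hq)

lemma S10.exists_isWeakGradient {Tri : Triangulation n Ω} {u : Tri.P1} (hu : u ∈ Tri.S10) :
    ∃ g, IsWeakGradient Ω u.toFun g := by
  obtain ⟨_, g, hg, _⟩ := hu
  exact ⟨g, hg⟩

/-- To evaluate LS along a line in S¹₀ a weak gradient suffices; the boundary condition need not be
carried along. -/
lemma S10.exists_isWeakGradient_add_smul {Tri : Triangulation n Ω} {u w : Tri.P1}
    (hu : u ∈ Tri.S10) (hw : w ∈ Tri.S10) (δ : ℝ) :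
    ∃ g, IsWeakGradient Ω (u + δ • w).toFun g := by
  obtain ⟨hu2, g, hg, _⟩ := hu
  obtain ⟨hw2, k, hk, _⟩ := hw
  have : (u + δ • w).toFun = fun x => u.toFun x + δ * w.toFun x := by
    ext x
    simp only [P1.toFun, glue, Finset.mul_sum, ← Finset.sum_add_distrib]
    refine Finset.sum_congr rfl fun T _ => ?_
    by_cases hx : x ∈ interior (hull T.1) <;> simp [hx]
  rw [this]
  exact ⟨_, hg.add_const_smul hk hu2 hw2 δ⟩

lemma RT0.exists_isWeakDivergence_add_smul {Tri : Triangulation n Ω} {p q : Tri.RTCoeff}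
    (hp : p ∈ Tri.RT0) (hq : q ∈ Tri.RT0) (δ : ℝ) :
    ∃ d, IsWeakDivergence Ω (p + δ • q).toFun d := by
  obtain ⟨hp2, g, hg⟩ := hp
  obtain ⟨hq2, k, hk⟩ := hq
  have : (p + δ • q).toFun = fun x => p.toFun x + δ • q.toFun x := by
    ext1 x
    simp only [RTCoeff.toFun, glue, Finset.smul_sum, ← Finset.sum_add_distrib]
    refine Finset.sum_congr rfl fun T _ => ?_
    by_cases hx : x ∈ interior (hull T.1)
    · simp only [indicator_of_mem hx, RTCoeff.onCell, Pi.add_apply, Pi.smul_apply, Prod.fst_add,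
        Prod.snd_add, Prod.smul_fst, Prod.smul_snd, smul_eq_mul]
      module
    · simp [indicator_of_notMem hx]
  rw [this]
  exact ⟨_, hg.add_const_smul hk hp2 hq2 δ⟩

end Triangulation

/-! ### Fields that jump across a hyperplane -/

section HalfSpace

open Metric Topology Pointwise

variable {n : ℕ}

lemma gradient_comp_add_left (χ : E n → ℝ) (c y : E n) :
    gradient (fun x => χ (x - c)) (c + y) = gradient χ y := by
  rw [gradient, gradient, fderiv_comp_sub, add_sub_cancel_left]

lemma IsTestFunction.comp_sub {Ω : Set (E n)} {χ : E n → ℝ} (h : IsTestFunction Ω χ) (c : E n)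
    {Ω' : Set (E n)} (hs : ∀ y ∈ Ω, c + y ∈ Ω') : IsTestFunction Ω' fun x => χ (x - c) := by
  refine ⟨h.1.comp (contDiff_id.sub contDiff_const),
    h.2.1.comp_homeomorph (Homeomorph.subRight c), ?_⟩
  have : tsupport (fun x => χ (x - c)) = (Homeomorph.subRight c) ⁻¹' tsupport χ :=
    tsupport_comp_eq_preimage χ (Homeomorph.subRight c)
  rw [this]
  intro x hx
  have := hs _ (h.2.2 hx)
  simpa using this

/-- Test functions vanishing against the divergence of `1_H (a + β y)` on a half-space `H`. -/
lemma setIntegral_halfSpace_inner_gradient {ν a : E n} {β r : ℝ} (hr : 0 < r)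
    (H : ∀ χ, IsTestFunction (ball (0 : E n) r) χ →
      ∫ y in {y | 0 < inner ℝ ν y}, (inner ℝ (a + β • y) (gradient χ y) + (n * β) * χ y) = 0)
    {χ : E n → ℝ} (hχ : IsTestFunction (ball (0 : E n) r) χ) :
    ∫ y in {y | 0 < inner ℝ ν y}, inner ℝ a (gradient χ y) = 0 := by
  have h2 : IsTestFunction (ball (0 : E n) r) fun y => χ ((2 : ℝ) • y) := by
    refine ⟨hχ.1.comp (contDiff_const_smul _),
      hχ.2.1.comp_homeomorph (Homeomorph.smulOfNeZero (2 : ℝ) two_ne_zero), ?_⟩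
    have : tsupport (fun y => χ ((2 : ℝ) • y)) =
        (Homeomorph.smulOfNeZero (2 : ℝ) two_ne_zero) ⁻¹' tsupport χ :=
      tsupport_comp_eq_preimage χ (Homeomorph.smulOfNeZero (2 : ℝ) two_ne_zero)
    rw [this]
    intro y hy
    have := hχ.2.2 hy
    simp only [Homeomorph.smulOfNeZero_apply, mem_ball_zero_iff, norm_smul] at this ⊢
    norm_num at this
    linarith [norm_nonneg y]
  have hg : ∀ y, gradient (fun y => χ ((2 : ℝ) • y)) y = (2 : ℝ) • gradient χ ((2 : ℝ) • y) := by
    intro y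
    rw [gradient, gradient, fderiv_comp_smul, map_smul]
  have e1 := H χ hχ
  -- Testing with χ(2 •) and substituting z = 2y maps the half-space to itself and doubles the
  -- weight of the constant part `a` only. The difference to the identity for χ leaves `a` alone.
  have e2 := H _ h2
  have hsc : (2 : ℝ) • {y : E n | 0 < inner ℝ ν y} = {y : E n | 0 < inner ℝ ν y} := by
    ext y
    rw [mem_smul_set_iff_inv_smul_mem₀ two_ne_zero]
    simp [inner_smul_right]
  have e3 : ∀ y, inner ℝ (a + β • y) (gradient (fun y => χ ((2 : ℝ) • y)) y) +
      (n * β) * χ ((2 : ℝ) • y) =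
      (fun z => 2 * inner ℝ a (gradient χ z) + inner ℝ (β • z) (gradient χ z) + (n * β) * χ z)
        ((2 : ℝ) • y) := by
    intro y
    simp only [hg, inner_add_left, inner_smul_left, inner_smul_right]
    simp
    ring
  rw [integral_congr_ae (.of_forall e3), Measure.setIntegral_comp_smul_of_pos volume
    (fun z => 2 * inner ℝ a (gradient χ z) + inner ℝ (β • z) (gradient χ z) + (n * β) * χ z) _
    (by norm_num : (0 : ℝ) < 2), hsc, smul_eq_zero] at e2
  have e2 := e2.resolve_left (by positivity)
  have i1 : IntegrableOn (fun y => inner ℝ a (gradient χ y)) {y | 0 < inner ℝ ν y} :=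
    ((continuous_const.inner hχ.continuous_gradient).integrable_of_hasCompactSupport
      (hχ.hasCompactSupport_gradient.comp_left (g := fun w => inner ℝ a w)
        (inner_zero_right _))).integrableOn
  have i2 : IntegrableOn (fun y => inner ℝ (a + β • y) (gradient χ y) + (n * β) * χ y)
      {y | 0 < inner ℝ ν y} := by
    have := (hχ.integral_radial_inner_gradient a 0 β).1
    simp only [sub_zero] at this
    exact (this.add ((hχ.continuous.integrable_of_hasCompactSupport hχ.2.1).const_mul _)).integrableOn
  have e4 : ∀ z, 2 * inner ℝ a (gradient χ z) + inner ℝ (β • z) (gradient χ z) + (n * β) * χ z =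
      inner ℝ a (gradient χ z) + (inner ℝ (a + β • z) (gradient χ z) + (n * β) * χ z) := by
    intro z
    rw [inner_add_left]
    ring
  simp_rw [e4] at e2
  rwa [integral_add i1 i2, e1, add_zero] at e2

/-- The hypothesis says that the half-space indicator, mollified by a bump, has zero derivative
along `a` near the origin. If `a` crossed the hyperplane, a small shift along it would strictly
increase the mass of the bump in the half-space. -/
lemma inner_eq_zero_of_setIntegral_halfSpace {ν a : E n} {r : ℝ} (hr : 0 < r)
    (H : ∀ χ, IsTestFunction (ball (0 : E n) r) χ →
      ∫ y in {y | 0 < inner ℝ ν y}, inner ℝ a (gradient χ y) = 0) : inner ℝ ν a = 0 := by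
  by_contra hc
  let g : ContDiffBump (0 : E n) := ⟨r / 6, r / 3, by positivity, by linarith⟩
  set h : Set (E n) := {y | 0 < inner ℝ ν y} with hh
  have hopen : IsOpen h := isOpen_lt continuous_const (by fun_prop)
  -- The sign of τ makes the shift point into the half-space. With shift and bump radius at most
  -- r/3, all translated bumps stay inside the ball of radius r.
  obtain ⟨τ, hτ1, hτ2⟩ : ∃ τ : ℝ, 0 < τ * inner ℝ ν a ∧ ‖τ • a‖ < r / 3 := by
    have ha : 0 < ‖a‖ := norm_pos_iff.2 fun h0 => hc (by rw [h0, inner_zero_right])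
    refine ⟨(r / 6 / (‖a‖ * |inner ℝ ν a|)) * inner ℝ ν a, ?_, ?_⟩
    · rw [mul_assoc]
      have := abs_pos.2 hc
      exact mul_pos (by positivity) (mul_self_pos.2 hc)
    · rw [norm_smul, norm_mul, Real.norm_eq_abs (inner ℝ ν a), Real.norm_of_nonneg (by positivity)]
      have := abs_pos.2 hc
      field_simp
      linarith
  set L := ContinuousLinearMap.mul ℝ ℝ
  set f : E n → ℝ := h.indicator fun _ => 1 with hf
  have hfl : LocallyIntegrable f volume :=
    (locallyIntegrable_const (1 : ℝ)).indicator hopen.measurableSet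
  set Φ := convolution f g L volume with hΦ
  have hder := fun x => g.hasCompactSupport.hasFDerivAt_convolution_right L hfl
    (g.contDiff (n := 1)) x
  have hzero : ∀ x, ‖x‖ < r / 3 →
      convolution f (fderiv ℝ g) (L.precompR (E n)) volume x a = 0 := by
    intro x hx
    rw [convolution_precompR_apply L hfl (g.hasCompactSupport.fderiv ℝ)
      ((g.contDiff (n := 1)).continuous_fderiv one_ne_zero), convolution_def]
    have ht : IsTestFunction (ball (0 : E n) r) fun t => g (x - t) := by
      refine ⟨g.contDiff.comp (contDiff_const.sub contDiff_id),
        g.hasCompactSupport.comp_homeomorph (Homeomorph.subLeft x), ?_⟩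
      have : tsupport (fun t => g (x - t)) = (Homeomorph.subLeft x) ⁻¹' tsupport g :=
        tsupport_comp_eq_preimage g (Homeomorph.subLeft x)
      rw [this, g.tsupport_eq]
      intro t ht
      simp only [mem_preimage, Homeomorph.subLeft_apply, mem_closedBall_zero_iff,
        mem_ball_zero_iff] at ht ⊢
      have : ‖t‖ ≤ ‖x‖ + ‖x - t‖ := by
        calc ‖t‖ = ‖x - (x - t)‖ := by rw [sub_sub_cancel]
          _ ≤ _ := norm_sub_le _ _
      have hg : g.rOut = r / 3 := rfl
      linarith
    have := H _ ht
    rw [← integral_indicator hopen.measurableSet] at this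
    rw [← neg_eq_zero, ← integral_neg, ← this]
    congr 1
    ext t
    by_cases htH : t ∈ h
    · rw [indicator_of_mem htH, hf, indicator_of_mem htH, inner_gradient_right]
      simp only [conj_trivial]
      have : fderiv ℝ (fun t => g (x - t)) t = -fderiv ℝ g (x - t) := by
        have h1 := ((g.contDiff (n := 1)).differentiable one_ne_zero (x - t)).hasFDerivAt
        have h2 := h1.comp t ((hasFDerivAt_id t).const_sub x)
        refine h2.fderiv.trans ?_
        ext; simp
      rw [this]
      simp [L]
    · rw [indicator_of_notMem htH, hf, indicator_of_notMem htH]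
      simp
  have hconst : Φ (τ • a) = Φ 0 := by
    have hd : ∀ s ∈ Icc (0 : ℝ) 1, HasDerivAt (fun s : ℝ => Φ (s • (τ • a))) 0 s := by
      intro s hs
      have h1 : HasDerivAt (fun s : ℝ => s • (τ • a)) ((1 : ℝ) • (τ • a)) s :=
        (hasDerivAt_id s).smul_const _
      have h2 := (hder (s • (τ • a))).comp_hasDerivAt s h1
      have h3 : ‖s • (τ • a)‖ < r / 3 := by
        rw [norm_smul, Real.norm_of_nonneg hs.1]
        nlinarith [norm_nonneg (τ • a), hs.2]
      rw [one_smul, map_smul, hzero _ h3, smul_zero] at h2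
      exact h2
    have := constant_of_has_deriv_right_zero (a := (0 : ℝ)) (b := 1)
      (fun s hs => (hd s hs).continuousAt.continuousWithinAt)
      (fun s hs => (hd s (Ico_subset_Icc_self hs)).hasDerivWithinAt) 1 (right_mem_Icc.2 zero_le_one)
    simpa using this
  have hval : ∀ x, Φ x = ∫ y in {y | 0 < inner ℝ ν (x - y)}, g y := by
    intro x
    have hm : MeasurableSet {y : E n | 0 < inner ℝ ν (x - y)} :=
      (isOpen_lt continuous_const (by fun_prop)).measurableSet
    rw [hΦ, convolution_eq_swap, ← integral_indicator hm]
    congr 1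
    ext t
    by_cases ht : t ∈ {y : E n | 0 < inner ℝ ν (x - y)}
    · rw [indicator_of_mem ht, hf, indicator_of_mem (show x - t ∈ h from ht)]
      simp [L]
    · rw [indicator_of_notMem ht, hf, indicator_of_notMem (show x - t ∉ h from ht)]
      simp [L]
  have hgi : Integrable (g : E n → ℝ) volume :=
    g.continuous.integrable_of_hasCompactSupport g.hasCompactSupport
  have hm0 : MeasurableSet {y : E n | 0 < inner ℝ ν (0 - y)} :=
    (isOpen_lt continuous_const (by fun_prop)).measurableSet
  have hsub : {y : E n | 0 < inner ℝ ν (0 - y)} ⊆ {y : E n | 0 < inner ℝ ν (τ • a - y)} := by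
    intro y hy
    simp only [mem_ofPred_eq, inner_sub_right, inner_smul_right, inner_zero_right] at hy ⊢
    linarith
  have hdiff := setIntegral_sdiff (μ := volume) hm0 hgi.integrableOn hsub
  rw [← hval, ← hval, hconst, sub_self] at hdiff
  -- The slab swept by the shift meets the support of the bump in a nonempty open set, which
  -- contains half the shift vector.
  have hU : IsOpen ({y : E n | 0 < inner ℝ ν (τ • a - y)} ∩ {y : E n | 0 < inner ℝ ν y} ∩
      ball (0 : E n) (r / 3)) :=
    ((isOpen_lt continuous_const (by fun_prop)).inter
      (isOpen_lt continuous_const (by fun_prop))).inter isOpen_ball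
  have hne : ({y : E n | 0 < inner ℝ ν (τ • a - y)} ∩ {y : E n | 0 < inner ℝ ν y} ∩
      ball (0 : E n) (r / 3)).Nonempty := by
    refine ⟨(1 / 2 : ℝ) • (τ • a), ⟨?_, ?_⟩, ?_⟩
    · simp only [mem_ofPred_eq, inner_sub_right, inner_smul_right]
      linarith
    · simp only [mem_ofPred_eq, inner_smul_right]
      linarith
    · rw [mem_ball_zero_iff, norm_smul]
      norm_num
      linarith [norm_nonneg (τ • a)]
  have hpos := hU.measure_pos volume hne
  have := (setIntegral_pos_iff_support_of_nonneg_ae (μ := volume) (f := fun x => g x)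
    (s := {y | 0 < inner ℝ ν (τ • a - y)} \ {y | 0 < inner ℝ ν (0 - y)})
    (.of_forall fun x => g.nonneg' x) hgi.integrableOn).2 (hpos.trans_le (measure_mono ?_))
  · rw [hdiff] at this
    exact lt_irrefl _ this
  · rintro y ⟨⟨h1, h2⟩, h3⟩
    refine ⟨?_, h1, ?_⟩
    · rw [g.support_eq]; exact h3
    · simp only [mem_ofPred_eq, zero_sub, inner_neg_right] at h2 ⊢
      linarith

end HalfSpace

/-! ### Continuity of normal components in RT₀ -/

namespace Triangulation

open Metric Topology

variable {n : ℕ} {Ω : Set (E n)} (Tri : Triangulation n Ω)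

/-- The barycenter of a side. -/
def sideMid (F : Finset (E n)) : E n := ∑ z ∈ F, (n : ℝ)⁻¹ • z

lemma sideMid_mem (hn : 1 ≤ n) (F : Tri.sides) : sideMid F.1 ∈ hull F.1 := by
  have hn0 : (n : ℝ) ≠ 0 := by exact_mod_cast (by omega : n ≠ 0)
  refine (convex_convexHull ℝ _).sum_mem (fun _ _ => by positivity) ?_
    fun z hz => subset_convexHull ℝ _ hz
  simp [Tri.card_side F, hn0]

lemma affine_sideMid (hn : 1 ≤ n) (F : Tri.sides) (v : E n →ᵃ[ℝ] ℝ) :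
    v (sideMid F.1) = (n : ℝ)⁻¹ * ∑ z ∈ F.1, v z := by
  have hn0 : (n : ℝ) ≠ 0 := by exact_mod_cast (by omega : n ≠ 0)
  have h : ∀ z, v z = v 0 + inner ℝ (affGrad v) z := fun z => by rw [affine_eq v z 0, sub_zero]
  rw [Finset.sum_congr rfl fun z _ => h z, h, sideMid, Finset.sum_add_distrib, inner_sum]
  simp only [inner_smul_right, ← Finset.mul_sum, Finset.sum_const, Tri.card_side F]
  field_simp
  simp [mul_comm]

lemma coord_sideMid_pos (hn : 1 ≤ n) {T : Tri.cells} {F : Tri.sides} {w : {z // z ∈ T.1}}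
    (hw : w.1 ∈ F.1) (hF : F ∈ Tri.sidesOf T) :
    0 < (Tri.cellBasis T).coord w (sideMid F.1) := by
  classical
  have hn0 : (0 : ℝ) < n := by exact_mod_cast hn
  rw [Tri.affine_sideMid hn, Finset.sum_eq_single w.1]
  · have : (Tri.cellBasis T).coord w (w : E n) = 1 := (Tri.cellBasis T).coord_apply_eq w
    rw [this]
    positivity
  · intro z hz hzw
    exact (Tri.cellBasis T).coord_apply_ne (j := ⟨z, Tri.mem_sidesOf.1 hF hz⟩)
      fun h => hzw (congrArg Subtype.val h).symm
  · exact fun h => absurd hw h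

lemma coord_sideMid_add (hn : 1 ≤ n) {T : Tri.cells} {F : Tri.sides} (hF : F ∈ Tri.sidesOf T)
    {z : {z // z ∈ T.1}} (hz : z.1 ∉ F.1) (y : E n) :
    (Tri.cellBasis T).coord z (sideMid F.1 + y) =
      inner ℝ (affGrad ((Tri.cellBasis T).coord z)) y := by
  rw [affine_eq _ _ (sideMid F.1), Tri.coord_side hF hz (Tri.sideMid_mem hn F), zero_add,
    add_sub_cancel_left]

lemma eventually_coord_pos (hn : 1 ≤ n) {T : Tri.cells} {F : Tri.sides} (hF : F ∈ Tri.sidesOf T)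
    {z : {z // z ∈ T.1}} (hz : z.1 ∉ F.1) :
    ∀ᶠ y in 𝓝 (0 : E n), ∀ w, w ≠ z → 0 < (Tri.cellBasis T).coord w (sideMid F.1 + y) := by
  refine Filter.eventually_all.2 fun w => ?_
  by_cases hw : w = z
  · exact .of_forall fun y h => absurd hw h
  · have hc : Continuous fun y => (Tri.cellBasis T).coord w (sideMid F.1 + y) :=
      (continuous_affine _).comp (by fun_prop)
    have h0 : 0 < (Tri.cellBasis T).coord w (sideMid F.1 + 0) := by
      rw [add_zero]
      exact Tri.coord_sideMid_pos hn ((Tri.mem_side_iff hF hz w).2 hw) hF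
    filter_upwards [hc.continuousAt.eventually (lt_mem_nhds h0)] with y hy _ using hy

/-- The normal components of a piecewise Raviart-Thomas function in `H(div)` have no jumps. -/
lemma normal_jump_eq_zero (hn : 1 ≤ n) (hΩ : interior (closure Ω) = Ω) {ν : Tri.sides → E n}
    (hν : Tri.IsOrientation ν) {q : Tri.RTCoeff} (hq : q ∈ Tri.RT0) {S T : Tri.cells} (hST : S ≠ T)
    {F : Tri.sides} (hFS : F ∈ Tri.sidesOf S) (hFT : F ∈ Tri.sidesOf T) :
    inner ℝ (q.onCell S (sideMid F.1)) (ν F) = inner ℝ (q.onCell T (sideMid F.1)) (ν F) := by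
  obtain ⟨zS, hzS⟩ := Tri.exists_opposite S F
  obtain ⟨zT, hzT⟩ := Tri.exists_opposite T F
  obtain ⟨cS, hcS, hcS1⟩ := Tri.orientation_eq_smul hn hν hFS hzS
  obtain ⟨cT, hcT, hcT1⟩ := Tri.orientation_eq_smul hn hν hFT hzT
  have hS := Tri.eventually_coord_pos hn hFS hzS
  have hT := Tri.eventually_coord_pos hn hFT hzT
  have cS' := Tri.coord_sideMid_add hn hFS hzS
  have cT' := Tri.coord_sideMid_add hn hFT hzT
  have hgT0 := Tri.affGrad_cell_ne_zero hn T zT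
  set gS := affGrad ((Tri.cellBasis S).coord zS)
  set gT := affGrad ((Tri.cellBasis T).coord zT)
  set x₀ := sideMid F.1 with hx₀
  have hcS0 : cS ≠ 0 := fun h => by simp [h] at hcS1
  have hcT0 : cT ≠ 0 := fun h => by simp [h] at hcT1
  have hgS : ∀ y, inner ℝ gS y = (cT / cS) * inner ℝ gT y := by
    intro y
    have : gS = (cT / cS) • gT := by
      rw [div_eq_inv_mul, mul_smul, ← hcT, hcS, smul_smul, inv_mul_cancel₀ hcS0, one_smul]
    rw [this, inner_smul_left]; simp
  obtain ⟨r, hr, hball⟩ := Metric.eventually_nhds_iff_ball.1 (hS.and hT)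
  have intS : ∀ y ∈ ball (0 : E n) r, 0 < inner ℝ gS y → x₀ + y ∈ interior (hull S.1) := by
    intro y hy h
    refine (Tri.mem_interior_hull S _).2 fun w => ?_
    by_cases hw : w = zS
    · rw [hw, cS']; exact h
    · exact (hball y hy).1 w hw
  have intT : ∀ y ∈ ball (0 : E n) r, 0 < inner ℝ gT y → x₀ + y ∈ interior (hull T.1) := by
    intro y hy h
    refine (Tri.mem_interior_hull T _).2 fun w => ?_
    by_cases hw : w = zT
    · rw [hw, cT']; exact h
    · exact (hball y hy).2 w hw
  -- The cells lie on opposite sides of `F`: otherwise a point slightly off the barycenter of `F`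
  -- would be interior to both.
  have hneg : cT / cS < 0 := by
    refine lt_of_le_of_ne (not_lt.1 fun hpos => ?_) (div_ne_zero hcT0 hcS0)
    obtain ⟨ε, hε, hεr⟩ : ∃ ε : ℝ, 0 < ε ∧ ‖ε • gT‖ < r := by
      refine ⟨r / (2 * ‖gT‖), by positivity, ?_⟩
      rw [norm_smul, Real.norm_of_nonneg (by positivity)]
      have := norm_pos_iff.2 hgT0
      field_simp
      linarith
    have h1 : 0 < inner ℝ gT (ε • gT) := by
      rw [inner_smul_right, real_inner_self_eq_norm_sq]; positivity
    have hb : ε • gT ∈ ball (0 : E n) r := by simpa using hεr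
    exact (Tri.disjoint_interior hST).le_bot
      ⟨intS _ hb (by rw [hgS]; exact mul_pos hpos h1), intT _ hb h1⟩
  have hsub : ∀ y ∈ ball (0 : E n) r, x₀ + y ∈ Ω := by
    have hcl : ball x₀ r ⊆ closure Ω := by
      intro x hx
      have hy : x - x₀ ∈ ball (0 : E n) r := by
        rwa [mem_ball_zero_iff, ← dist_eq_norm]
      have hxe : x = x₀ + (x - x₀) := by abel
      rw [← Tri.cover]
      rcases le_or_gt 0 (inner ℝ gT (x - x₀)) with h | h
      · refine mem_biUnion (x := T.1) T.2 ((Tri.mem_hull T x).2 fun w => ?_)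
        rw [hxe]
        by_cases hw : w = zT
        · rw [hw, cT']; exact h
        · exact ((hball _ hy).2 w hw).le
      · refine mem_biUnion (x := S.1) S.2 ((Tri.mem_hull S x).2 fun w => ?_)
        rw [hxe]
        by_cases hw : w = zS
        · rw [hw, cS', hgS]; exact (mul_pos_of_neg_of_neg hneg h).le
        · exact ((hball _ hy).1 w hw).le
    intro y hy
    refine hΩ.subset (interior_maximal hcl isOpen_ball ?_)
    simpa [mem_ball, dist_eq_norm] using hy
  set a := q.onCell T x₀ - q.onCell S x₀ with ha
  set β := (q T).2 - (q S).2 with hβ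
  have hmain : ∀ χ, IsTestFunction (ball (0 : E n) r) χ →
      ∫ y in {y | 0 < inner ℝ gT y}, (inner ℝ (a + β • y) (gradient χ y) + (n * β) * χ y) = 0 := by
    intro χ hχ
    set ψ : E n → ℝ := fun x => χ (x - x₀) with hψ
    have hψt : IsTestFunction Ω ψ := hχ.comp_sub x₀ hsub
    obtain ⟨hq2, d, hd⟩ := hq
    have hdd := Tri.isWeakDivergence_ae hΩ hd
    have i1 : IntegrableOn (fun x => inner ℝ (q.toFun x) (gradient ψ x)) Ω :=
      memLp_one_iff_integrable.1 ((innerSL ℝ).memLp_of_bilin 1 hq2 (hψt.memLp_gradient _))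
    have i2 : IntegrableOn (fun x => d x * ψ x) Ω := hd.1.integrable_mul (hψt.memLp _)
    have e1 : ∫ x in Ω, (inner ℝ (q.toFun x) (gradient ψ x) + d x * ψ x) = 0 := by
      rw [integral_add i1 i2, hd.2 ψ hψt, neg_add_cancel]
    have e2 : ∫ x in Ω, (inner ℝ (q.toFun x) (gradient ψ x) + Tri.divNC q x * ψ x) = 0 := by
      rw [← e1]
      refine integral_congr_ae ?_
      filter_upwards [hdd] with x hx
      rw [hx]
    rw [setIntegral_eq_integral_of_forall_compl_eq_zero (fun x hx => by
      rw [hψt.gradient_eq_zero hx, hψt.eq_zero hx, inner_zero_right, mul_zero, add_zero]),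
      ← integral_add_left_eq_self _ x₀] at e2
    have hχψ : ∀ y, ψ (x₀ + y) = χ y := fun y => by simp [hψ]
    have hgψ : ∀ y, gradient ψ (x₀ + y) = gradient χ y := gradient_comp_add_left χ x₀
    simp_rw [hχψ, hgψ] at e2
    have hmeas : MeasurableSet {y : E n | 0 < inner ℝ gT y} :=
      (isOpen_lt continuous_const (by fun_prop)).measurableSet
    set B : E n → ℝ := fun y => inner ℝ (a + β • y) (gradient χ y) + (n * β) * χ y with hB
    -- Near the side, q is the polynomial of `S` everywhere plus the jump on the half-space of `T`.
    -- The first part, `A`, integrates to zero by integration by parts over the whole space.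
    set A : E n → ℝ := fun y => inner ℝ (q.onCell S x₀ + (q S).2 • (y - 0)) (gradient χ y) +
      (n * (q S).2) * χ y with hA
    have hχi : Integrable χ := hχ.continuous.integrable_of_hasCompactSupport hχ.2.1
    have iA : Integrable A :=
      (hχ.integral_radial_inner_gradient _ _ _).1.add (hχi.const_mul _)
    have iB : Integrable B := by
      have := (hχ.integral_radial_inner_gradient a 0 β).1.add (hχi.const_mul (n * β))
      simp only [sub_zero] at this
      exact this
    have eA : ∫ y, A y = 0 := by
      simp only [hA]
      rw [integral_add (hχ.integral_radial_inner_gradient _ _ _).1 (hχi.const_mul _),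
        (hχ.integral_radial_inner_gradient _ _ _).2, neg_add_cancel]
    have hnull : ∀ᵐ y : E n, inner ℝ gT y ≠ 0 := by
      have : volume (LinearMap.ker (innerₗ (E n) gT) : Set (E n)) = 0 := by
        refine Measure.addHaar_submodule _ _ fun htop => hgT0 ?_
        have : gT ∈ LinearMap.ker (innerₗ (E n) gT) := by rw [htop]; trivial
        simpa using this
      rw [ae_iff]
      convert this using 2
      ext y
      simp
    have hq' : ∀ (R : Tri.cells) (y : E n),
        q.onCell R (x₀ + y) = q.onCell R x₀ + (q R).2 • y := by
      intro R y
      simp only [RTCoeff.onCell]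
      module
    have hae : ∀ᵐ y : E n, inner ℝ (q.toFun (x₀ + y)) (gradient χ y) +
        Tri.divNC q (x₀ + y) * χ y = A y + {y : E n | 0 < inner ℝ gT y}.indicator B y := by
      filter_upwards [hnull] with y hy0
      by_cases hy : y ∈ ball (0 : E n) r
      · rcases lt_or_gt_of_ne hy0 with h | h
        · have hin := intS y hy (by rw [hgS]; exact mul_pos_of_neg_of_neg hneg h)
          rw [indicator_of_notMem (show y ∉ {y : E n | 0 < inner ℝ gT y} from not_lt.2 h.le),
            RTCoeff.toFun, divNC, Tri.glue_apply _ hin, Tri.glue_apply _ hin, hq', hA]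
          simp
        · have hin := intT y hy h
          rw [indicator_of_mem (show y ∈ {y : E n | 0 < inner ℝ gT y} from h),
            RTCoeff.toFun, divNC, Tri.glue_apply _ hin, Tri.glue_apply _ hin, hq', hA, hB]
          simp only [ha, hβ, sub_zero, sub_smul, inner_add_left, inner_sub_left]
          ring
      · have h1 := hχ.gradient_eq_zero hy
        have h2 := hχ.eq_zero hy
        have h3 : {y : E n | 0 < inner ℝ gT y}.indicator B y = 0 := by
          rw [indicator_apply_eq_zero]
          intro _
          simp only [hB, h1, h2, inner_zero_right, mul_zero, add_zero]
        rw [h3]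
        simp only [hA, h1, h2, inner_zero_right, mul_zero, add_zero]
    rw [integral_congr_ae hae, integral_add iA (iB.indicator hmeas), eA, zero_add,
      integral_indicator hmeas] at e2
    exact e2
  have hkey : inner ℝ gT a = 0 :=
    inner_eq_zero_of_setIntegral_halfSpace hr fun χ hχ =>
      setIntegral_halfSpace_inner_gradient hr hmain hχ
  rw [← sub_eq_zero, ← inner_sub_left, ← neg_sub, ← ha, inner_neg_left, hcT, inner_smul_right,
    real_inner_comm, hkey, mul_zero, neg_zero]

/-- Within a side, q varies only in tangential directions, so q · ν_F is constant there; the cells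
at the side agree on the constant because the normal jump vanishes. -/
lemma exists_hasNormalTrace (hn : 1 ≤ n) (hΩ : interior (closure Ω) = Ω) {ν : Tri.sides → E n}
    (hν : Tri.IsOrientation ν) {q : Tri.RTCoeff} (hq : q ∈ Tri.RT0) :
    ∃ t, Tri.HasNormalTrace ν q t := by
  have hν' := hν
  choose S hS hSν using hν'
  refine ⟨fun F => inner ℝ (q.onCell (S F) (sideMid F.1)) (ν F), fun T F hF x hx => ?_⟩
  have h1 : inner ℝ (q.onCell T x) (ν F) = inner ℝ (q.onCell T (sideMid F.1)) (ν F) := by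
    obtain ⟨z, hz⟩ := Tri.exists_opposite T F
    obtain ⟨c, hc, _⟩ := Tri.orientation_eq_smul hn hν hF hz
    rw [← sub_eq_zero, ← inner_sub_left]
    have h2 : q.onCell T x - q.onCell T (sideMid F.1) = (q T).2 • (x - sideMid F.1) := by
      simp only [RTCoeff.onCell]; module
    have h3 := affine_eq ((Tri.cellBasis T).coord z) x (sideMid F.1)
    rw [Tri.coord_side hF hz hx, Tri.coord_side hF hz (Tri.sideMid_mem hn F), zero_add] at h3
    rw [h2, hc, inner_smul_left, inner_smul_right, real_inner_comm, ← h3]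
    simp
  rw [h1]
  by_cases hST : S F = T
  · simp only [hST]
  · exact (Tri.normal_jump_eq_zero hn hΩ hν hq hST (hS F) hF).symm

end Triangulation

/-! ### The inverse square root of a positive definite matrix -/

section InvSqrt

variable {n : ℕ}

/-- The spectrum is positive, so s^(-1/2) is continuous on it and the calculus multiplies s by
s^(-1/2) twice. -/
lemma invSqrt_mul_self {A : Matrix (Fin n) (Fin n) ℝ} (hA : A.PosDef) :
    A * (cfc (fun s : ℝ => s ^ (-(1 / 2) : ℝ)) A * cfc (fun s : ℝ => s ^ (-(1 / 2) : ℝ)) A) = 1 := by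
  have hsa : IsSelfAdjoint A := hA.isHermitian
  have hpos : ∀ s ∈ spectrum ℝ A, 0 < s := by
    intro s hs
    rw [hA.isHermitian.spectrum_real_eq_range_eigenvalues] at hs
    obtain ⟨i, rfl⟩ := hs
    exact hA.eigenvalues_pos i
  have hc : ContinuousOn (fun s : ℝ => s ^ (-(1 / 2) : ℝ)) (spectrum ℝ A) :=
    fun s hs => (Real.continuousAt_rpow_const _ _ (Or.inl (hpos s hs).ne')).continuousWithinAt
  have h1 : A = cfc (fun s : ℝ => s) A := (cfc_id' ℝ A).symm
  conv_lhs => enter [1]; rw [h1]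
  rw [← cfc_mul _ _ A hc hc, ← cfc_mul (fun s : ℝ => s) _ A continuousOn_id (by exact hc.mul hc),
    ← cfc_one ℝ A]
  refine cfc_congr fun s hs => ?_
  have := hpos s hs
  simp only [Pi.one_apply]
  rw [← Real.rpow_add this]
  norm_num
  rw [Real.rpow_neg_one, mul_inv_cancel₀ this.ne']

end InvSqrt

/-! ### Cell averages and the weights on a cell -/

namespace Triangulation

variable {n : ℕ} {Ω : Set (E n)} (Tri : Triangulation n Ω)

lemma setIntegral_eq_sum_const (hΩ : interior (closure Ω) = Ω) {G : E n → ℝ} {c : Tri.cells → ℝ}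
    (h : ∀ᵐ x ∂volume.restrict Ω, ∀ T : Tri.cells, x ∈ interior (hull T.1) → G x = c T) :
    ∫ x in Ω, G x = ∑ T, Tri.cellVol T * c T := by
  rw [(Tri.setIntegral_eq_sum hΩ (G' := fun T _ => c T) h
    fun T => integrableOn_const (volume_hull_ne_top T.1)).2]
  simp [cellVol]

lemma setAverage_cell (T : Tri.cells) {V : Type*} [NormedAddCommGroup V] [NormedSpace ℝ V]
    (g : E n → V) : Tri.cellVol T • (⨍ y in hull T.1, g y) = ∫ y in hull T.1, g y := by
  rw [setAverage_eq, smul_smul, cellVol, mul_inv_cancel₀ (show volume.real (hull T.1) ≠ 0 from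
    (Tri.cellVol_pos T).ne'), one_smul]

lemma setAverage_congr_interior (T : Tri.cells) {V : Type*} [NormedAddCommGroup V]
    [NormedSpace ℝ V] {g g' : E n → V} (h : ∀ x ∈ interior (hull T.1), g x = g' x) :
    ⨍ y in hull T.1, g y = ⨍ y in hull T.1, g' y := by
  rw [setAverage_eq, setAverage_eq]
  congr 1
  rw [← Measure.restrict_congr_set (interior_ae_eq_hull T.1)]
  exact setIntegral_congr_fun isOpen_interior.measurableSet h

lemma isCompact_hull (T : Finset (E n)) : IsCompact (hull T) :=
  T.finite_toSet.isCompact_convexHull ℝ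

/-- The average of `f` on a cell. -/
def avg (f : E n → ℝ) (T : Tri.cells) : ℝ := ⨍ y in hull T.1, f y

/-- The average of `f (• - mid T)` on a cell. -/
def moment (f : E n → ℝ) (T : Tri.cells) : E n := ⨍ y in hull T.1, f y • (y - Tri.mid T)

/-- The matrix of second moments of a cell. -/
def secondMoment (T : Tri.cells) : Matrix (Fin n) (Fin n) ℝ :=
  Matrix.of fun i j => ⨍ y in hull T.1, (y - Tri.mid T) i * (y - Tri.mid T) j

/-- The map `I + S₀` on a cell. -/
def cellM (T : Tri.cells) : E n →ₗ[ℝ] E n := Matrix.toEuclideanLin (1 + Tri.secondMoment T)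

/-- The map `(I + S₀)^{-1/2}` on a cell. -/
def cellW (T : Tri.cells) : E n →ₗ[ℝ] E n :=
  Matrix.toEuclideanLin (cfc (fun s : ℝ => s ^ (-(1 / 2) : ℝ)) (1 + Tri.secondMoment T))

lemma Pi0_apply {V : Type*} [NormedAddCommGroup V] [NormedSpace ℝ V] (g : E n → V)
    {T : Tri.cells} {x : E n} (hx : x ∈ interior (hull T.1)) :
    Tri.Pi0 g x = ⨍ y in hull T.1, g y := Tri.glue_apply _ hx

lemma midField_apply {T : Tri.cells} {x : E n} (hx : x ∈ interior (hull T.1)) :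
    Tri.midField x = Tri.mid T := Tri.glue_apply _ hx

lemma H0_apply (f : E n → ℝ) {T : Tri.cells} {x : E n} (hx : x ∈ interior (hull T.1)) :
    Tri.H0 f x = Tri.moment f T := by
  rw [H0, Tri.Pi0_apply _ hx]
  exact Tri.setAverage_congr_interior T fun y hy => by rw [Tri.midField_apply hy]

lemma weight_apply {T : Tri.cells} {x : E n} (hx : x ∈ interior (hull T.1)) :
    Matrix.toEuclideanLin (Tri.weight x) = Tri.cellW T := by
  have : Tri.S0 x = Tri.secondMoment T := by
    ext i j
    rw [S0, secondMoment, Matrix.of_apply, Matrix.of_apply, Tri.Pi0_apply _ hx]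
    exact Tri.setAverage_congr_interior T fun y hy => by rw [Tri.midField_apply hy]
  rw [weight, this, cellW]

lemma integral_onCell (q : Tri.RTCoeff) (T : Tri.cells) :
    ⨍ y in hull T.1, q.onCell T y = (q T).1 := by
  have h : ∫ y in hull T.1, q.onCell T y = Tri.cellVol T • (q T).1 := by
    refine ext_inner_left ℝ fun e => ?_
    have hc : Continuous (q.onCell T) := by unfold RTCoeff.onCell; fun_prop
    have hi : IntegrableOn (q.onCell T) (hull T.1) := hc.continuousOn.integrableOn_compact
      (isCompact_hull T.1)
    rw [← integral_inner hi]
    have : ∀ y, inner ℝ e (q.onCell T y) =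
        affOf (Tri.mid T) (inner ℝ e (q T).1) ((q T).2 • e) y := by
      intro y
      rw [affOf_apply, RTCoeff.onCell, inner_add_right, inner_smul_right, inner_smul_left]
      simp
    simp_rw [this]
    rw [(Tri.setIntegral_cell T _).2, affOf_apply, inner_smul_right]
    simp
  rw [setAverage_eq, h, smul_smul, cellVol, inv_mul_cancel₀ (show volume.real (hull T.1) ≠ 0 from
    (Tri.cellVol_pos T).ne'), one_smul]

lemma Pi0_toFun_apply (q : Tri.RTCoeff) {T : Tri.cells} {x : E n}
    (hx : x ∈ interior (hull T.1)) : Tri.Pi0 q.toFun x = (q T).1 := by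
  rw [Tri.Pi0_apply _ hx, ← Tri.integral_onCell q T]
  exact Tri.setAverage_congr_interior T fun y hy => Tri.glue_apply _ hy

lemma inner_secondMoment (T : Tri.cells) (G G' : E n) :
    inner ℝ (Matrix.toEuclideanLin (Tri.secondMoment T) G) G' =
      ⨍ y in hull T.1, inner ℝ G (y - Tri.mid T) * inner ℝ G' (y - Tri.mid T) := by
  have hi : ∀ i j : Fin n, IntegrableOn
      (fun y : E n => (y - Tri.mid T) i * (y - Tri.mid T) j) (hull T.1) := fun i j => by
    refine ContinuousOn.integrableOn_compact (isCompact_hull T.1) (Continuous.continuousOn ?_)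
    fun_prop
  have e1 : ∀ y : E n, inner ℝ G (y - Tri.mid T) * inner ℝ G' (y - Tri.mid T) =
      ∑ i, ∑ j, (G j * G' i) * ((y - Tri.mid T) i * (y - Tri.mid T) j) := by
    intro y
    simp only [PiLp.inner_apply, RCLike.inner_apply, conj_trivial]
    rw [mul_comm, Finset.sum_mul_sum]
    refine Finset.sum_congr rfl fun i _ => Finset.sum_congr rfl fun j _ => ?_
    ring
  simp_rw [e1]
  rw [setAverage_eq, integral_finsetSum _ fun i _ => integrable_finsetSum _ fun j _ =>
    (hi i j).const_mul _, Finset.smul_sum]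
  simp only [PiLp.inner_apply, RCLike.inner_apply, conj_trivial, Matrix.toLpLin_apply]
  refine Finset.sum_congr rfl fun i _ => ?_
  rw [integral_finsetSum _ fun j _ => (hi i j).const_mul _, Finset.smul_sum]
  simp only [Matrix.mulVec, dotProduct, Finset.mul_sum]
  refine Finset.sum_congr rfl fun j _ => ?_
  rw [integral_const_mul, secondMoment, Matrix.of_apply, setAverage_eq, smul_eq_mul, smul_eq_mul]
  ring

lemma inner_cellM (T : Tri.cells) (G G' : E n) :
    inner ℝ (Tri.cellM T G) G' = inner ℝ G G' +
      ⨍ y in hull T.1, inner ℝ G (y - Tri.mid T) * inner ℝ G' (y - Tri.mid T) := by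
  rw [← inner_secondMoment, cellM, map_add, LinearMap.add_apply, inner_add_left]
  congr 2
  simp

/-- The quadratic form of the second moments is the mean of (G · (y - mid T))², hence nonnegative.
-/
lemma posDef_one_add_secondMoment (T : Tri.cells) : (1 + Tri.secondMoment T).PosDef := by
  refine Matrix.PosDef.add_posSemidef Matrix.PosDef.one ?_
  have hH : (Tri.secondMoment T).IsHermitian := by
    ext i j
    simp [secondMoment, Matrix.conjTranspose_apply, mul_comm]
  refine Matrix.PosSemidef.of_dotProduct_mulVec_nonneg hH fun x => ?_
  have := Tri.inner_secondMoment T (WithLp.toLp 2 x) (WithLp.toLp 2 x)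
  have h0 : 0 ≤ ⨍ y in hull T.1, inner ℝ (WithLp.toLp 2 x) (y - Tri.mid T) *
      inner ℝ (WithLp.toLp 2 x) (y - Tri.mid T) := by
    rw [setAverage_eq]
    exact mul_nonneg (inv_nonneg.2 measureReal_nonneg)
      (integral_nonneg fun y => mul_self_nonneg _)
  rw [← this] at h0
  refine h0.trans_eq ?_
  rw [EuclideanSpace.inner_eq_star_dotProduct]
  simp

lemma cellM_cellW_cellW (T : Tri.cells) (x : E n) :
    Tri.cellM T (Tri.cellW T (Tri.cellW T x)) = x := by
  have h := invSqrt_mul_self (Tri.posDef_one_add_secondMoment T)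
  have h2 := congrArg (fun B => Matrix.toEuclideanLin B x) h
  simpa [cellM, cellW, Matrix.toLpLin_apply, Matrix.mulVec_mulVec, Matrix.one_mulVec] using h2

lemma inner_cellW (T : Tri.cells) (x y : E n) :
    inner ℝ (Tri.cellW T x) y = inner ℝ x (Tri.cellW T y) := by
  have : (cfc (fun s : ℝ => s ^ (-(1 / 2) : ℝ)) (1 + Tri.secondMoment T)).IsHermitian :=
    cfc_predicate (R := ℝ) (p := IsSelfAdjoint) _ _
  exact (Matrix.isSymmetric_toEuclideanLin_iff.2 this) x y

end Triangulation

/-! ### Cellwise formulas and the Riesz representative -/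

section Functionals

open Triangulation

variable {n : ℕ} {Ω : Set (E n)} (Tri : Triangulation n Ω) (ν : Tri.sides → E n)
  (ϕ : ℝ → ℝ) (f : E n → ℝ)

/-- Expansion about the barycenter: the mixed terms have mean zero, and the product of the two
linear parts averages to S₀ applied to the gradients. -/
lemma scalarY_eq (hΩ : interior (closure Ω) = Ω) (v w : Tri.P1) :
    scalarY Tri v w = ∑ T, Tri.cellVol T * (v T (Tri.mid T) * w T (Tri.mid T) +
      inner ℝ (Tri.cellM T (affGrad (v T))) (affGrad (w T))) := by
  have hG : ∀ T : Tri.cells, IntegrableOn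
      (fun x => v T x * w T x + inner ℝ (affGrad (v T)) (affGrad (w T))) (hull T.1) := fun T => by
    have h1 := continuous_affine (v T)
    have h2 := continuous_affine (w T)
    refine ContinuousOn.integrableOn_compact (isCompact_hull T.1) (Continuous.continuousOn ?_)
    fun_prop
  rw [scalarY, (Tri.setIntegral_eq_sum hΩ (G' := fun T x =>
    v T x * w T x + inner ℝ (affGrad (v T)) (affGrad (w T))) ?_ hG).2]
  · refine Finset.sum_congr rfl fun T _ => ?_
    set a := v T (Tri.mid T)
    set b := w T (Tri.mid T)
    set G := affGrad (v T)
    set K := affGrad (w T)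
    have e : ∀ x, v T x * w T x + inner ℝ G K = affOf (Tri.mid T) (a * b + inner ℝ G K)
        (a • K + b • G) x + inner ℝ G (x - Tri.mid T) * inner ℝ K (x - Tri.mid T) := by
      intro x
      rw [affine_eq (v T) x (Tri.mid T), affine_eq (w T) x (Tri.mid T), affOf_apply,
        inner_add_left, inner_smul_left, inner_smul_left]
      simp only [conj_trivial]
      ring
    have hi : IntegrableOn (fun x => inner ℝ G (x - Tri.mid T) * inner ℝ K (x - Tri.mid T))
        (hull T.1) := by
      refine ContinuousOn.integrableOn_compact (isCompact_hull T.1) (Continuous.continuousOn ?_)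
      fun_prop
    simp_rw [e]
    rw [integral_add (Tri.setIntegral_cell T _).1 hi, (Tri.setIntegral_cell T _).2, affOf_apply,
      inner_cellM, ← Tri.setAverage_cell, sub_self, inner_zero_right, smul_eq_mul]
    ring
  · refine .of_forall fun x T hx => ?_
    rw [P1.toFun, P1.toFun, Tri.glue_apply _ hx, Tri.glue_apply _ hx, Tri.gradNC_apply _ hx,
      Tri.gradNC_apply _ hx]

lemma load_eq (hΩ : interior (closure Ω) = Ω) {f : E n → ℝ}
    (hf : MemLp f 2 (volume.restrict Ω)) (v : Tri.P1) :
    load Tri f v = ∑ T, Tri.cellVol T * (Tri.avg f T * v T (Tri.mid T) +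
      inner ℝ (Tri.moment f T) (affGrad (v T))) := by
  have hfi := fun T => Tri.integrableOn_cell hΩ T hf
  have hG : ∀ T : Tri.cells, IntegrableOn (fun x => f x * v T x) (hull T.1) := fun T =>
    (hfi T).mul_continuousOn (continuous_affine (v T)).continuousOn (isCompact_hull T.1)
  rw [load, (Tri.setIntegral_eq_sum hΩ (G' := fun T x => f x * v T x) ?_ hG).2]
  · refine Finset.sum_congr rfl fun T _ => ?_
    have hi : IntegrableOn (fun x => f x • (x - Tri.mid T)) (hull T.1) :=
      (hfi T).smul_continuousOn (Continuous.continuousOn (by fun_prop)) (isCompact_hull T.1)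
    have e : ∀ x, f x * v T x = v T (Tri.mid T) * f x +
        inner ℝ (affGrad (v T)) (f x • (x - Tri.mid T)) := by
      intro x
      rw [affine_eq (v T) x (Tri.mid T), inner_smul_right]
      ring
    simp_rw [e]
    rw [integral_add ((hfi T).const_mul _) (hi.const_inner _), integral_const_mul,
      integral_inner hi, ← Tri.setAverage_cell, ← Tri.setAverage_cell, inner_smul_right,
      smul_eq_mul, real_inner_comm, avg, moment]
    ring
  · refine .of_forall fun x T hx => ?_
    rw [P1.toFun, Tri.glue_apply _ hx]

lemma formB_eq (hΩ : interior (closure Ω) = Ω) {u : Tri.P1} (hu : u ∈ Tri.S10) (t : Tri.P0Sides)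
    (v : Tri.P1) :
    formB Tri ν ϕ u t v = (∑ T, Tri.cellVol T *
      inner ℝ (sigma ϕ (affGrad (u T))) (affGrad (v T))) - Tri.bracket ν t v := by
  rw [formB, Tri.setIntegral_eq_sum_const hΩ]
  filter_upwards [Tri.weakGrad_ae hΩ (S10.exists_isWeakGradient hu)] with x hx T hxT
  rw [hx, Tri.gradNC_apply _ hxT, Tri.gradNC_apply _ hxT]

lemma formB'_eq (hΩ : interior (closure Ω) = Ω) {u w : Tri.P1} (hu : u ∈ Tri.S10)
    (hw : w ∈ Tri.S10) (s : Tri.P0Sides) (v : Tri.P1) :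
    formB' Tri ν ϕ u w s v = (∑ T, Tri.cellVol T * inner ℝ (affGrad (w T))
      (fderiv ℝ (sigma ϕ) (affGrad (u T)) (affGrad (v T)))) - Tri.bracket ν s v := by
  rw [formB', Tri.setIntegral_eq_sum_const hΩ]
  filter_upwards [Tri.weakGrad_ae hΩ (S10.exists_isWeakGradient hu),
    Tri.weakGrad_ae hΩ (S10.exists_isWeakGradient hw)] with x hx hx' T hxT
  rw [hx, hx', Tri.gradNC_apply _ hxT, Tri.gradNC_apply _ hxT, Tri.gradNC_apply _ hxT]

/-- The flux residual on a cell. -/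
def fluxRes (u : Tri.P1) (p : Tri.RTCoeff) (T : Tri.cells) : E n :=
  (p T).1 - sigma ϕ (affGrad (u T)) + Tri.moment f T

/-- The divergence residual on a cell. -/
def divRes (p : Tri.RTCoeff) (T : Tri.cells) : ℝ := Tri.avg f T + (n : ℝ) * (p T).2

lemma leastSquares_eq (hΩ : interior (closure Ω) = Ω) {u : Tri.P1} {p : Tri.RTCoeff}
    (hu : ∃ g, IsWeakGradient Ω u.toFun g) (hp : ∃ d, IsWeakDivergence Ω p.toFun d) :
    leastSquares Tri ϕ f u p = ∑ T, Tri.cellVol T *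
      (‖Tri.cellW T (fluxRes Tri ϕ f u p T)‖ ^ 2 + divRes Tri f p T ^ 2) := by
  rw [leastSquares, Tri.setIntegral_eq_sum_const hΩ
      (c := fun T => ‖Tri.cellW T (fluxRes Tri ϕ f u p T)‖ ^ 2),
    Tri.setIntegral_eq_sum_const hΩ (c := fun T => divRes Tri f p T ^ 2), ← Finset.sum_add_distrib]
  · simp_rw [mul_add]
  · filter_upwards [Tri.weakDiv_ae hΩ hp] with x hx T hxT
    rw [hx, Tri.Pi0_apply _ hxT, divNC, Tri.glue_apply _ hxT, divRes, avg]
  · filter_upwards [Tri.weakGrad_ae hΩ hu] with x hx T hxT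
    rw [hx, Tri.gradNC_apply _ hxT, Tri.Pi0_toFun_apply _ hxT, Tri.H0_apply _ hxT,
      Tri.weight_apply hxT, fluxRes]

/-- The Riesz representation of the residual. -/
def riesz (u : Tri.P1) (p : Tri.RTCoeff) : Tri.P1 := fun T =>
  affOf (Tri.mid T) (divRes Tri f p T) (Tri.cellW T (Tri.cellW T (fluxRes Tri ϕ f u p T)))

lemma residual_eq_sum (hn : 1 ≤ n) (hΩ : interior (closure Ω) = Ω) (hν : Tri.IsOrientation ν)
    {f : E n → ℝ} (hf : MemLp f 2 (volume.restrict Ω)) {u : Tri.P1} (hu : u ∈ Tri.S10)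
    {t : Tri.P0Sides} {p : Tri.RTCoeff} (hpt : Tri.HasNormalTrace ν p t) (v : Tri.P1) :
    load Tri f v - formB Tri ν ϕ u t v = ∑ T, Tri.cellVol T *
      (divRes Tri f p T * v T (Tri.mid T) +
        inner ℝ (fluxRes Tri ϕ f u p T) (affGrad (v T))) := by
  rw [load_eq Tri hΩ hf, formB_eq Tri ν ϕ hΩ hu, Tri.bracket_eq hn hν hpt,
    ← Finset.sum_sub_distrib, ← Finset.sum_sub_distrib]
  refine Finset.sum_congr rfl fun T _ => ?_
  rw [divRes, fluxRes, inner_add_left, inner_sub_left]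
  ring

/-- Applying (I + S₀)^(-1/2) twice to the flux residual inverts the matrix I + S₀ of the scalar
product on gradients. -/
lemma residual_eq_riesz (hn : 1 ≤ n) (hΩ : interior (closure Ω) = Ω) (hν : Tri.IsOrientation ν)
    {f : E n → ℝ} (hf : MemLp f 2 (volume.restrict Ω)) {u : Tri.P1} (hu : u ∈ Tri.S10)
    {t : Tri.P0Sides} {p : Tri.RTCoeff} (hpt : Tri.HasNormalTrace ν p t) (v : Tri.P1) :
    load Tri f v - formB Tri ν ϕ u t v = scalarY Tri (riesz Tri ϕ f u p) v := by
  rw [residual_eq_sum Tri ν ϕ hn hΩ hν hf hu hpt, scalarY_eq Tri hΩ]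
  refine Finset.sum_congr rfl fun T _ => ?_
  rw [riesz, affGrad_affOf, Tri.cellM_cellW_cellW, affOf_apply]
  simp

lemma scalarY_riesz (hΩ : interior (closure Ω) = Ω) {u : Tri.P1} {p : Tri.RTCoeff}
    (hu : ∃ g, IsWeakGradient Ω u.toFun g) (hp : ∃ d, IsWeakDivergence Ω p.toFun d) :
    scalarY Tri (riesz Tri ϕ f u p) (riesz Tri ϕ f u p) = leastSquares Tri ϕ f u p := by
  rw [leastSquares_eq Tri ϕ f hΩ hu hp, scalarY_eq Tri hΩ]
  refine Finset.sum_congr rfl fun T _ => ?_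
  rw [riesz, affGrad_affOf, Tri.cellM_cellW_cellW, affOf_apply, ← Tri.inner_cellW,
    real_inner_self_eq_norm_sq]
  simp
  left
  ring

lemma scalarY_self_nonneg (v : Tri.P1) : 0 ≤ scalarY Tri v v := by
  unfold scalarY
  exact integral_nonneg fun x => add_nonneg (mul_self_nonneg _) real_inner_self_nonneg

lemma scalarY_add_smul (hΩ : interior (closure Ω) = Ω) (v w : Tri.P1) (c : ℝ) :
    scalarY Tri (v + c • w) (v + c • w) =
      scalarY Tri v v + 2 * c * scalarY Tri v w + c ^ 2 * scalarY Tri w w := by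
  simp only [scalarY_eq Tri hΩ, Finset.mul_sum, ← Finset.sum_add_distrib]
  refine Finset.sum_congr rfl fun T _ => ?_
  have hs : inner ℝ (Tri.cellM T (affGrad (w T))) (affGrad (v T)) =
      inner ℝ (Tri.cellM T (affGrad (v T))) (affGrad (w T)) := by
    rw [inner_cellM, inner_cellM, real_inner_comm]
    simp_rw [mul_comm]
  simp only [Pi.add_apply, Pi.smul_apply, affGrad_add, affGrad_smul, map_add, map_smul,
    inner_add_left, inner_add_right, inner_smul_left, inner_smul_right, AffineMap.coe_add,
    AffineMap.coe_smul, hs, smul_eq_mul, conj_trivial]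
  ring

lemma scalarY_smul_right (hΩ : interior (closure Ω) = Ω) (v w : Tri.P1) (c : ℝ) :
    scalarY Tri v (c • w) = c * scalarY Tri v w := by
  simp only [scalarY_eq Tri hΩ, Finset.mul_sum]
  refine Finset.sum_congr rfl fun T _ => ?_
  simp only [Pi.smul_apply, affGrad_smul, inner_smul_right, AffineMap.coe_smul, smul_eq_mul]
  ring

/-- Cauchy-Schwarz, from the discriminant of c ↦ a(v + c w, v + c w) ≥ 0. -/
lemma scalarY_sq_le (hΩ : interior (closure Ω) = Ω) (v w : Tri.P1) :
    scalarY Tri v w ^ 2 ≤ scalarY Tri v v * scalarY Tri w w := by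
  have h : ∀ c : ℝ, 0 ≤ scalarY Tri w w * (c * c) + 2 * scalarY Tri v w * c + scalarY Tri v v := by
    intro c
    have := scalarY_self_nonneg Tri (v + c • w)
    rw [scalarY_add_smul Tri hΩ] at this
    linarith
  have := discrim_le_zero h
  rw [discrim] at this
  linarith

/-- The dual norm of the residual is the norm of its Riesz representation. -/
lemma isGreatest_normY_riesz (hn : 1 ≤ n) (hΩ : interior (closure Ω) = Ω) (hν : Tri.IsOrientation ν)
    {f : E n → ℝ} (hf : MemLp f 2 (volume.restrict Ω)) {u : Tri.P1} (hu : u ∈ Tri.S10)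
    {t : Tri.P0Sides} {p : Tri.RTCoeff} (hpt : Tri.HasNormalTrace ν p t) :
    IsGreatest (residualSet Tri ν ϕ f u t) (normY Tri (riesz Tri ϕ f u p)) := by
  set r := riesz Tri ϕ f u p with hr
  have hres := residual_eq_riesz Tri ν ϕ hn hΩ hν hf hu hpt
  have hN : normY Tri r ^ 2 = scalarY Tri r r := Real.sq_sqrt (scalarY_self_nonneg Tri r)
  have hN0 : 0 ≤ normY Tri r := Real.sqrt_nonneg _
  -- The supremum is attained at the normalized representative. If its norm is 0, the convention 0⁻¹
  -- = 0 gives the zero test function, which attains the value 0.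
  refine ⟨⟨(normY Tri r)⁻¹ • r, ?_, ?_⟩, ?_⟩
  · have h1 : scalarY Tri ((normY Tri r)⁻¹ • r) ((normY Tri r)⁻¹ • r) ≤ 1 := by
      have := scalarY_add_smul Tri hΩ 0 r (normY Tri r)⁻¹
      have h0 : ∀ w, scalarY Tri 0 w = 0 := fun w => by
        rw [scalarY_eq Tri hΩ]
        refine Finset.sum_eq_zero fun T _ => ?_
        have : affGrad (0 : E n →ᵃ[ℝ] ℝ) = 0 := by simp [affGrad]
        simp [this]
      rw [zero_add, h0, h0, ← hN] at this
      rw [this]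
      rcases eq_or_ne (normY Tri r) 0 with h | h
      · simp [h]
      · field_simp
        simp
    rw [normY]
    exact Real.sqrt_le_one.2 h1
  · rw [hres, scalarY_smul_right Tri hΩ, ← hN]
    rcases eq_or_ne (normY Tri r) 0 with h | h
    · simp [h]
    · rw [sq, inv_mul_cancel_left₀ h, abs_of_nonneg hN0]
  · rintro _ ⟨v, hv, rfl⟩
    rw [hres]
    refine abs_le_of_sq_le_sq ?_ hN0
    have h1 : scalarY Tri v v ≤ 1 := by
      rw [normY, Real.sqrt_le_one] at hv
      exact hv
    rw [hN]
    exact (scalarY_sq_le Tri hΩ r v).trans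
      (mul_le_of_le_one_right (scalarY_self_nonneg Tri r) h1)

end Functionals

/-! ### Differentiability of σ -/

section Sigma

variable {n : ℕ} {ϕ : ℝ → ℝ} {γ₁ γ₂ : ℝ}

/-- `σ` is differentiable with symmetric derivative. -/
lemma exists_hasFDerivAt_sigma (hϕ : IsAdmissible ϕ γ₁ γ₂) (A : E n) :
    ∃ D : E n →L[ℝ] E n, HasFDerivAt (sigma ϕ) D A ∧
      ∀ x y, inner ℝ x (D y) = inner ℝ y (D x) := by
  rcases eq_or_ne A 0 with rfl | hA
  · refine ⟨ϕ 0 • ContinuousLinearMap.id ℝ (E n), ?_, fun x y => ?_⟩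
    -- At the origin the derivative is ϕ(0) times the identity, and continuity of ϕ at 0 is enough.
    · rw [hasFDerivAt_iff_isLittleO_nhds_zero, Asymptotics.isLittleO_iff]
      intro c hc
      have hcont : Filter.Tendsto (fun x : E n => ϕ ‖x‖) (nhds 0) (nhds (ϕ 0)) := by
        have h1 := hϕ.continuousOn 0 self_mem_Ici
        refine h1.tendsto.comp (tendsto_nhdsWithin_iff.2 ⟨?_, .of_forall fun x => norm_nonneg x⟩)
        simpa using (continuous_norm (E := E n)).tendsto 0
      filter_upwards [Metric.tendsto_nhds.1 hcont c hc] with x hx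
      have : sigma ϕ (0 + x) - sigma ϕ 0 - (ϕ 0 • ContinuousLinearMap.id ℝ (E n)) x =
          (ϕ ‖x‖ - ϕ 0) • x := by
        simp [sigma, sub_smul]
      rw [this, norm_smul]
      exact mul_le_mul_of_nonneg_right (le_of_lt hx) (norm_nonneg x)
    · simp [inner_smul_right, real_inner_comm]
  · have hpos : 0 < ‖A‖ := norm_pos_iff.2 hA
    -- With ϕ(|A|) written through |A|², the derivative is a multiple of the identity plus a
    -- multiple of A ⊗ A, which is visibly symmetric.
    have hd : DifferentiableAt ℝ (fun s => ϕ (Real.sqrt s)) (‖A‖ ^ 2) := by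
      have h1 : DifferentiableAt ℝ ϕ (Real.sqrt (‖A‖ ^ 2)) := by
        rw [Real.sqrt_sq hpos.le]
        exact (hϕ.contDiffOn.differentiableOn two_ne_zero).differentiableAt (Ioi_mem_nhds hpos)
      exact h1.comp _ (Real.hasDerivAt_sqrt (by positivity)).differentiableAt
    have h2 := hd.hasDerivAt.comp_hasFDerivAt A (hasStrictFDerivAt_norm_sq A).hasFDerivAt
    have h3 := h2.smul (hasFDerivAt_id A)
    have heq : sigma ϕ = fun x : E n => ((fun s => ϕ (Real.sqrt s)) ∘ fun x : E n => ‖x‖ ^ 2) x • id x := by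
      ext1 x
      simp [sigma, Real.sqrt_sq (norm_nonneg x)]
    rw [heq]
    refine ⟨_, h3, fun x y => ?_⟩
    simp [inner_add_right, inner_smul_right, real_inner_comm]
    ring

end Sigma

/-! ### Proof of the three statements -/

section Main

open Triangulation

variable {n : ℕ} {Ω : Set (E n)} (Tri : Triangulation n Ω) (ν : Tri.sides → E n)
  (ϕ : ℝ → ℝ) (f : E n → ℝ)

lemma residualNorm_sq (hn : 1 ≤ n) (hΩ : interior (closure Ω) = Ω) (hν : Tri.IsOrientation ν)
    {f : E n → ℝ} (hf : MemLp f 2 (volume.restrict Ω)) {u : Tri.P1} (hu : u ∈ Tri.S10)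
    {t : Tri.P0Sides} {p : Tri.RTCoeff} (hp : p ∈ Tri.RT0) (hpt : Tri.HasNormalTrace ν p t) :
    residualNorm Tri ν ϕ f u t ^ 2 = leastSquares Tri ϕ f u p := by
  rw [residualNorm, (isGreatest_normY_riesz Tri ν ϕ hn hΩ hν hf hu hpt).csSup_eq, normY,
    Real.sq_sqrt (scalarY_self_nonneg Tri _),
    scalarY_riesz Tri ϕ f hΩ (S10.exists_isWeakGradient hu) hp.2]

lemma residualNorm_nonneg (u : Tri.P1) (t : Tri.P0Sides) : 0 ≤ residualNorm Tri ν ϕ f u t := by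
  refine Real.sSup_nonneg ?_
  rintro _ ⟨v, _, rfl⟩
  exact abs_nonneg _

lemma scalarY_comm (v w : Tri.P1) : scalarY Tri v w = scalarY Tri w v := by
  simp only [scalarY, mul_comm, real_inner_comm]

/-- The scalar product is definite: in the cellwise formula, I + S₀ ≥ I, so a vanishing norm forces
zero barycentric values and gradients. -/
lemma eq_of_scalarY_eq (hΩ : interior (closure Ω) = Ω) {v r : Tri.P1}
    (h : ∀ η, scalarY Tri v η = scalarY Tri r η) (T : Tri.cells) :
    v T (Tri.mid T) = r T (Tri.mid T) ∧ affGrad (v T) = affGrad (r T) := by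
  have h0 : scalarY Tri (v + (-1 : ℝ) • r) (v + (-1 : ℝ) • r) = 0 := by
    rw [scalarY_add_smul Tri hΩ, h v, h r, scalarY_comm Tri r v, h r]
    ring
  rw [scalarY_eq Tri hΩ] at h0
  set η := v + (-1 : ℝ) • r
  have hM : ∀ T, ‖affGrad (η T)‖ ^ 2 ≤ inner ℝ (Tri.cellM T (affGrad (η T))) (affGrad (η T)) := by
    intro T
    rw [Tri.inner_cellM, real_inner_self_eq_norm_sq, setAverage_eq]
    exact le_add_of_nonneg_right (mul_nonneg (inv_nonneg.2 measureReal_nonneg)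
      (integral_nonneg fun y => mul_self_nonneg _))
  have h1 := (Finset.sum_eq_zero_iff_of_nonneg fun T _ => mul_nonneg (Tri.cellVol_pos T).le
    (add_nonneg (mul_self_nonneg _) ((sq_nonneg _).trans (hM T)))).1 h0 T (Finset.mem_univ T)
  have h2 := (mul_eq_zero.1 h1).resolve_left (Tri.cellVol_pos T).ne'
  have h3 := hM T
  have h4 : η T (Tri.mid T) = 0 := by
    nlinarith [mul_self_nonneg (η T (Tri.mid T)), sq_nonneg ‖affGrad (η T)‖]
  have h5 : affGrad (η T) = 0 := by
    rw [← norm_eq_zero]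
    nlinarith [mul_self_nonneg (η T (Tri.mid T)), sq_nonneg ‖affGrad (η T)‖]
  simp only [η, Pi.add_apply, Pi.smul_apply, affGrad_add, affGrad_smul, AffineMap.coe_add,
    AffineMap.coe_smul, smul_eq_mul] at h4 h5
  refine ⟨by linarith, ?_⟩
  rw [← sub_eq_zero, ← h5]
  module

lemma hasDerivAt_leastSquares (hn : 1 ≤ n) (hΩ : interior (closure Ω) = Ω)
    (hν : Tri.IsOrientation ν) {γ₁ γ₂ : ℝ} {ϕ : ℝ → ℝ} (hϕ : IsAdmissible ϕ γ₁ γ₂) {f : E n → ℝ}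
    (hf : MemLp f 2 (volume.restrict Ω)) {u v : Tri.P1} {t : Tri.P0Sides}
    (h : IsMixedSolution Tri ν ϕ f u t v) {p : Tri.RTCoeff} (hp : p ∈ Tri.RT0)
    (hpt : Tri.HasNormalTrace ν p t) {w : Tri.P1} (hw : w ∈ Tri.S10) {q : Tri.RTCoeff}
    (hq : q ∈ Tri.RT0) :
    HasDerivAt (fun δ : ℝ => leastSquares Tri ϕ f (u + δ • w) (p + δ • q)) 0 0 := by
  obtain ⟨hu, hmix, hcrit⟩ := h
  obtain ⟨s, hs⟩ := Tri.exists_hasNormalTrace hn hΩ hν hq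
  -- The first mixed equation says that `v` represents the residual, so its values at the
  -- barycenters and its gradients are the weighted residuals in LS.
  have hv := eq_of_scalarY_eq Tri hΩ (v := v) (r := riesz Tri ϕ f u p) fun η => by
    rw [← residual_eq_riesz Tri ν ϕ hn hΩ hν hf hu hpt, ← hmix η]
    ring
  have hvm : ∀ T, v T (Tri.mid T) = divRes Tri f p T := fun T => by
    rw [(hv T).1, riesz, affOf_apply]; simp
  have hvg : ∀ T, affGrad (v T) = Tri.cellW T (Tri.cellW T (fluxRes Tri ϕ f u p T)) := fun T => by
    rw [(hv T).2, riesz, affGrad_affOf]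
  simp_rw [fun δ => leastSquares_eq Tri ϕ f hΩ (S10.exists_isWeakGradient_add_smul hu hw δ)
    (RT0.exists_isWeakDivergence_add_smul hp hq δ)]
  choose D hD hsymm using fun T : Tri.cells => exists_hasFDerivAt_sigma hϕ (affGrad (u T))
  have hflux : ∀ T, HasDerivAt (fun δ : ℝ => fluxRes Tri ϕ f (u + δ • w) (p + δ • q) T)
      ((q T).1 - D T (affGrad (w T))) 0 := by
    intro T
    have h1 : HasDerivAt (fun δ : ℝ => affGrad (u T) + δ • affGrad (w T)) (affGrad (w T)) 0 := by
      simpa using ((hasDerivAt_id (0 : ℝ)).smul_const (affGrad (w T))).const_add (affGrad (u T))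
    have h2 : HasDerivAt (fun δ : ℝ => (p T).1 + δ • (q T).1) (q T).1 0 := by
      simpa using ((hasDerivAt_id (0 : ℝ)).smul_const (q T).1).const_add (p T).1
    have hD' : HasFDerivAt (sigma ϕ) (D T) (affGrad (u T) + (0 : ℝ) • affGrad (w T)) := by
      simpa using hD T
    have h3 := (h2.sub (hD'.comp_hasDerivAt (0 : ℝ) h1)).add_const (Tri.moment f T)
    refine h3.congr_of_eventuallyEq (.of_forall fun δ => ?_)
    simp [fluxRes, affGrad_add, affGrad_smul]
  have hdiv : ∀ T, HasDerivAt (fun δ : ℝ => divRes Tri f (p + δ • q) T) ((n : ℝ) * (q T).2) 0 := by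
    intro T
    have h1 : HasDerivAt (fun δ : ℝ => (p T).2 + δ * (q T).2) (q T).2 0 := by
      simpa using ((hasDerivAt_id (0 : ℝ)).mul_const (q T).2).const_add (p T).2
    have h2 := (h1.const_mul (n : ℝ)).const_add (Tri.avg f T)
    refine h2.congr_of_eventuallyEq (.of_forall fun δ => ?_)
    simp [divRes]
  have hterm : ∀ T, HasDerivAt (fun δ : ℝ => Tri.cellVol T *
      (‖Tri.cellW T (fluxRes Tri ϕ f (u + δ • w) (p + δ • q) T)‖ ^ 2 +
        divRes Tri f (p + δ • q) T ^ 2))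
      (Tri.cellVol T * (2 * (inner ℝ (affGrad (v T)) ((q T).1 - D T (affGrad (w T))) +
        v T (Tri.mid T) * ((n : ℝ) * (q T).2)))) 0 := by
    intro T
    have h1 := ((LinearMap.toContinuousLinearMap (Tri.cellW T)).hasFDerivAt.comp_hasDerivAt
      (0 : ℝ) (hflux T)).norm_sq
    have h2 := ((h1.add ((hdiv T).pow 2)).const_mul (Tri.cellVol T))
    refine HasDerivAt.congr_deriv (f' := _) h2 ?_
    rw [hvm, hvg, Tri.inner_cellW]
    simp
    left
    ring
  have hsum := HasDerivAt.fun_sum (u := Finset.univ) fun T _ => hterm T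
  refine hsum.congr_deriv ?_
  have hc := hcrit w hw s
  rw [formB'_eq Tri ν ϕ hΩ hu hw, Tri.bracket_eq hn hν hs, ← Finset.sum_sub_distrib] at hc
  -- The derivative is -2 times the form in the second mixed equation; the symmetry of Dσ moves it
  -- from ∇w to ∇v.
  rw [← neg_eq_zero, ← mul_eq_zero_of_right 2 hc, Finset.mul_sum, ← Finset.sum_neg_distrib]
  refine Finset.sum_congr rfl fun T _ => ?_
  rw [(hD T).fderiv, inner_sub_right, hsymm T (affGrad (v T)), real_inner_comm (affGrad (v T))]
  ring

end Main

end DPG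

end

open DPG DPG.Triangulation in
theorem theorem6 (n : ℕ) (hn : 1 ≤ n) (Ω : Set (E n)) (hΩ : interior (closure Ω) = Ω)
    (Tri : Triangulation n Ω) (ν : Tri.sides → E n) (hν : Tri.IsOrientation ν)
    (ϕ : ℝ → ℝ) (γ₁ γ₂ : ℝ) (hϕ : IsAdmissible ϕ γ₁ γ₂)
    (f : E n → ℝ) (hf : MeasureTheory.MemLp f 2 (MeasureTheory.volume.restrict Ω)) :
    (∀ u ∈ Tri.S10, ∀ t : Tri.P0Sides, ∀ p ∈ Tri.RT0, Tri.HasNormalTrace ν p t →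
      BddAbove (residualSet Tri ν ϕ f u t) ∧
      residualNorm Tri ν ϕ f u t ^ 2 = leastSquares Tri ϕ f u p) ∧
    (∀ (u : Tri.P1) (t : Tri.P0Sides), IsDPGSolution Tri ν ϕ f u t →
      ∀ p ∈ Tri.RT0, Tri.HasNormalTrace ν p t →
      ∀ w ∈ Tri.S10, ∀ q ∈ Tri.RT0, leastSquares Tri ϕ f u p ≤ leastSquares Tri ϕ f w q) ∧
    (∀ (u : Tri.P1) (t : Tri.P0Sides) (v : Tri.P1), IsMixedSolution Tri ν ϕ f u t v →
      ∀ p ∈ Tri.RT0, Tri.HasNormalTrace ν p t →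
      ∀ w ∈ Tri.S10, ∀ q ∈ Tri.RT0,
        HasDerivAt (fun δ : ℝ => leastSquares Tri ϕ f (u + δ • w) (p + δ • q)) 0 0) := by
  refine ⟨fun u hu t p hp hpt => ⟨(isGreatest_normY_riesz Tri ν ϕ hn hΩ hν hf hu hpt).bddAbove,
    residualNorm_sq Tri ν ϕ hn hΩ hν hf hu hp hpt⟩, ?_, fun u t v h p hp hpt w hw q hq =>
    hasDerivAt_leastSquares Tri ν hn hΩ hν hϕ hf h hp hpt hw hq⟩
  rintro u t ⟨hu, hmin⟩ p hp hpt w hw q hq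
  -- The normal trace of q makes (w, s) a competitor for the dPG solution, with residual norm
  -- squared equal to LS(w, q).
  obtain ⟨s, hs⟩ := Tri.exists_hasNormalTrace hn hΩ hν hq
  rw [← residualNorm_sq Tri ν ϕ hn hΩ hν hf hu hp hpt,
    ← residualNorm_sq Tri ν ϕ hn hΩ hν hf hw hq hs]
  exact pow_le_pow_left₀ (residualNorm_nonneg Tri ν ϕ f u t) (hmin w hw s) 2
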